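/- **Setting.** Let $PV$ (pointer variables) and $Y$ (universal variables) be finite sets, $D$ a data domain with a first-order signature, and $F$ a finite join-semilattice, with bottom $\mathit{false}$ and top $\mathit{true}$, of pairwise inequivalent quantifier-free formulas over the atoms $d(y)$, $y\in Y$, whose order implies implication. A *data word* is a word over $2^{PV}\times D$ in which every $p\in PV$ occurs exactly once; a *valuation word* extends a data word by marking, for each $y\in Y$, exactly one position with $y$, at most one $y$ per position. A *QDA* $\mathcal A=(Q,q_0,\delta,f)$ has finitely many states, a partial transition function $\delta: Q\times(2^{PV}\times(Y\cup\{-\}))\rightharpoonup Q$ and $f:Q\to F$; inputs in which some variable does not occur exactly once have no run or end in a state with $f=\mathit{false}$. It accepts a valuation word if the run exists and the data at the positions of $Y$ satisfy $f$ of the last state; $\mathcal L(\mathcal A)$ is the set of data words all of whose valuation words are accepted. $\mathcal A$ is *elastic* (an EQDA) if every transition on the blank letter $\underline b=(\emptyset,-)$ is a self-loop. **Configurations.** A configuration $c$ is a linear layout of finitely many cells with an assignment of the pointer variables to cells, a distinguished variable $\mathit{nil}$ being at the first cell. For a given set of auxiliary pointer variables (those introduced only by the encoding), the *proper* cells are those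 to which no auxiliary variable points, and exactly these carry data. A data word $w$ *corresponds* to $c$ if it lists the cells of $c$ in order, with arbitrary data at the cells that are not proper. The variables $y\in Y$ of formulas range over proper cells; $u<v$ (for lists $u\to^+v$) is the order of the layout. **Translation.** Let $p$ be a simple path, with non-blank letters $\pi_0\dots\pi_{n-1}$ and states $q_0,\dots,q_n$, from the initial state to a state $q_p=q_n$ with $f(q_p)\ne\mathit{false}$. Irrelevance of blank self-loops on $p$ is defined inductively: if $\pi_i=(\emptyset,y)$ with $y\in Y$, then a self-loop at one of $q_i,q_{i+1}$ is irrelevant on $p$ if the other state has no self-loop or has one that is irrelevant on $p$. All other self-loops are relevant. The constraint $\phi_p$ is the conjunction of: - $u<v$, whenever $u,v$ are on consecutive letters $\pi_i,\pi_{i+1}$ and the state $q_{i+1}$ between them has a relevant self-loop (where a letter that contains pointers is represented by its pointers only); - $v=x+(j-i)$, whenever $x\in PV$ is on $\pi_i$, $v$ is a variable on $\pi_j$, and no state between these letters has a relevant self-loop; - $x+(n-i)=\mathit{size}$ (the structure ends $n-i$ cells after $x$), whenever $x\in PV$ is on $\pi_i$ and none of $q_{i+1},\dots,q_n$ has a relevant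 self-loop. The Strand formula is $$\mathcal T(\mathcal A)=\bigwedge_p\forall Y.\,(\phi_p\Rightarrow f(q_p))\ \wedge\ \forall Y.\,\Big(\bigwedge_{y\ne z}y\ne z\wedge\neg\bigvee_p\phi_p\ \Rightarrow\ \mathit{false}\Big).$$ The formula $\mathcal T_{\mathrm{APF}}(\mathcal A)$ in the array property fragment, whose guards are positive combinations of $\le$ and $=$ without arithmetic on universal variables, is $$\mathcal T_{\mathrm{APF}}(\mathcal A)=\bigwedge_p\forall Y.\,\Big(\phi_p^{\le}\Rightarrow f(q_p)\vee\bigvee_{(y,z)}d(y)=d(z)\Big)\ \wedge\ \forall Y.\,\Big(\gamma\Rightarrow\bigvee_{y\neq z}d(y)=d(z)\Big).$$ Here $\phi_p^\le$ is $\phi_p$ with each conjunct $y<z$ between $y,z\in Y$ relaxed to $y\le z$, the first disjunction is over these pairs $(y,z)$, and $\gamma$ is $\neg\bigvee_p\phi_p$ with the negations of relations between two universal variables removed. **Theorem 4.** Let $\mathcal A$ be an EQDA, $w$ a data word and $c$ a configuration to which $w$ corresponds. 1. If $w\in\mathcal L(\mathcal A)$, then $c\models\mathcal T(\mathcal A)$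 and $c\models\mathcal T_{\mathrm{APF}}(\mathcal A)$; moreover $\gamma$ fails in $c$ for all valuations of $Y$ in pairwise distinct proper cells. 2. Conversely, assume that every word that contains every variable exactly once, has $\mathit{nil}$ on its first letter, and has some $y\in Y$ on a letter together with an auxiliary variable, has a run that ends in a state with $f=\mathit{true}$. (This is vacuous if there are no auxiliary variables.) If $c$ satisfies the Strand formula $\mathcal T(\mathcal A)$, then $w\in\mathcal L(\mathcal A)$. -/

import Mathlib

/-! ### Data formulas -/

/-- A finite (semi-)lattice of data formulas: the elements of `F` stand for quantifier-free
first-order formulas over the atoms `d(y)`, `y ∈ Y`, interpreted in the data domain `D`.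
In a formula of type `L.Formula Y` the variable `y` stands for `d(y)`. -/
structure FormulaLattice (L : FirstOrder.Language) (D : Type*) [L.Structure D] (Y F : Type*)
    [SemilatticeSup F] [BoundedOrder F] where
  formula : F → L.Formula Y
  isQF : ∀ a, (formula a).IsQF
  formula_bot : formula ⊥ = ⊥
  formula_top : formula ⊤ = ⊤
  le_imp : ∀ a b, a ≤ b → ∀ r : Y → D, (formula a).Realize r → (formula b).Realize r
  inequivalent : ∀ a b, (∀ r : Y → D, (formula a).Realize r ↔ (formula b).Realize r) → a = b

/-! ### Words -/

/-- Letters of symbolic words: a set of pointer variables, and a universal variable or `none`. -/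
abbrev Letter (PV Y : Type*) := Finset PV × Option Y

/-- The letter carrying no variable at all. -/
def blank {PV Y : Type*} : Letter PV Y := (∅, none)

/-- Every pointer variable occurs at exactly one position. -/
def IsDataWord {PV D : Type*} (w : List (Finset PV × D)) : Prop :=
  ∀ x : PV, ∃! i : Fin w.length, x ∈ (w.get i).1

/-- Every pointer variable and every universal variable occurs at exactly one position. -/
def ValidSymbolic {PV Y : Type*} (u : List (Letter PV Y)) : Prop :=
  (∀ x : PV, ∃! i : Fin u.length, x ∈ (u.get i).1) ∧
  (∀ y : Y, ∃! i : Fin u.length, (u.get i).2 = some y)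

/-- The data word underlying a word over `Σ × D × (Y ∪ {-})`. -/
def toDataWord {PV Y D : Type*} (v : List (Finset PV × D × Option Y)) : List (Finset PV × D) :=
  v.map fun a => (a.1, a.2.1)

def IsValuationWord {PV Y D : Type*} (v : List (Finset PV × D × Option Y)) : Prop :=
  IsDataWord (toDataWord v) ∧ ∀ y : Y, ∃! i : Fin v.length, (v.get i).2.2 = some y

/-! ### Quantified data automata -/

/-- A quantified data automaton with state set `Q` and final evaluations in `F`;
`none` is a missing transition. -/
structure QDA (PV Y F Q : Type*) where
  init : Q
  δ : Q → Letter PV Y → Option Q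
  out : Q → F

namespace QDA

variable {PV Y F Q : Type*}

/-- The run on a symbolic word from a given state. -/
def runFrom (A : QDA PV Y F Q) : Q → List (Letter PV Y) → Option Q
  | q, [] => some q
  | q, a :: u => (A.δ q a).bind fun q' => A.runFrom q' u

def run (A : QDA PV Y F Q) (u : List (Letter PV Y)) : Option Q := A.runFrom A.init u

/-- The automaton verifies the constraints on the number of occurrences of variables: violating
inputs have no run or end in a state with final formula `false`. -/
def ChecksInput [SemilatticeSup F] [BoundedOrder F] (A : QDA PV Y F Q) : Prop :=
  ∀ u, ¬ ValidSymbolic u → ∀ q, A.run u = some q → A.out q = ⊥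

/-- Every transition on the blank letter is a self-loop. -/
def Elastic (A : QDA PV Y F Q) : Prop :=
  ∀ q q', A.δ q blank = some q' → q = q'

/-- One step on a configuration: state and registers (a partial assignment `Y ⇀ D`). -/
def step [DecidableEq Y] {D : Type*} (A : QDA PV Y F Q) (s : Q × (Y → Option D))
    (a : Finset PV × D × Option Y) : Option (Q × (Y → Option D)) :=
  (A.δ s.1 (a.1, a.2.2)).map fun q' =>
    (q', match a.2.2 with
      | some y => Function.update s.2 y (some a.2.1)
      | none => s.2)

def steps [DecidableEq Y] {D : Type*} (A : QDA PV Y F Q) :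
    Q × (Y → Option D) → List (Finset PV × D × Option Y) → Option (Q × (Y → Option D))
  | s, [] => some s
  | s, a :: v => (A.step s a).bind fun s' => A.steps s' v

variable {L : FirstOrder.Language} {D : Type*} [L.Structure D]
  [SemilatticeSup F] [BoundedOrder F]

/-- Acceptance of a valuation word. -/
def AcceptsValuation [DecidableEq Y] (A : QDA PV Y F Q) (Φ : FormulaLattice L D Y F)
    (v : List (Finset PV × D × Option Y)) : Prop :=
  ∃ (q : Q) (r : Y → Option D) (s : Y → D),
    A.steps (A.init, fun _ => none) v = some (q, r) ∧ (∀ y, r y = some (s y)) ∧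
      (Φ.formula (A.out q)).Realize s

/-- The language of data words of the automaton. -/
def language [DecidableEq Y] (A : QDA PV Y F Q) (Φ : FormulaLattice L D Y F) :
    Set (List (Finset PV × D)) :=
  {w | IsDataWord w ∧ ∀ v, IsValuationWord v → toDataWord v = w → A.AcceptsValuation Φ v}

/-- Every word, with `nil` read first, along which some universal variable is read together with an
auxiliary pointer variable (one introduced only by the encoding) goes to the formula `true`. -/
def AuxTrue (A : QDA PV Y F Q) (aux : Finset PV) (nil : PV) : Prop :=
  ∀ u : List (Letter PV Y), ValidSymbolic u → (∃ a ∈ u.head?, nil ∈ a.1) →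
    (∃ a ∈ u, ∃ x ∈ aux, x ∈ a.1 ∧ ∃ y, a.2 = some y) →
    ∃ q, A.run u = some q ∧ A.out q = ⊤

end QDA

/-! ### Program configurations -/

/-- A program configuration: the cells of its lists and arrays, laid out one after the other in the
predetermined order, the pointer variables, and the data of the proper cells. A cell to which an
auxiliary variable points is an artefact of the encoding and carries no data. `nil` comes first. -/
structure Config {PV : Type*} (D : Type*) (aux : Finset PV) (nil : PV) where
  size : ℕ
  ptr : PV → Fin size
  ptr_nil : (ptr nil : ℕ) = 0
  data : {i : Fin size // ∀ x ∈ aux, ptr x ≠ i} → D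

namespace Config

variable {PV D : Type*} {aux : Finset PV} {nil : PV}

/-- The proper memory cells (list nodes, array entries, scalars). -/
abbrev Cell (c : Config D aux nil) := {i : Fin c.size // ∀ x ∈ aux, c.ptr x ≠ i}

/-- `w` is a data word encoding `c`; at the auxiliary cells the data of `w` is arbitrary. -/
def Encodes (c : Config D aux nil) (w : List (Finset PV × D)) : Prop :=
  ∃ h : w.length = c.size, ∀ i : Fin w.length,
    (∀ x, x ∈ (w.get i).1 ↔ c.ptr x = Fin.cast h i) ∧
    ∀ hi : (∀ x ∈ aux, c.ptr x ≠ Fin.cast h i), (w.get i).2 = c.data ⟨Fin.cast h i, hi⟩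

/-- Position of a pointer variable or, under the valuation `val`, of a universal variable. -/
def pos {Y : Type*} (c : Config D aux nil) (val : Y → c.Cell) : PV ⊕ Y → ℤ
  | .inl x => ((c.ptr x : ℕ) : ℤ)
  | .inr y => (((val y).1 : ℕ) : ℤ)

end Config

/-! ### The two target logics -/

/-- Atomic structural formulas. Two universal variables can be related only by the elastic relation
`before`; distances are always measured from a pointer variable (for the universal variables these
are the monadic distance predicates).
* `before u v`: `u < v`, i.e. `u →⁺ v`;
* `offset v x k`: `v` is `k` steps after the pointer `x` (`v = x` for `k = 0`, and before `x` for
  negative `k`);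
* `atEnd x k`: the structure ends `k` steps after `x`. -/
inductive PosAtom (PV Y : Type*) where
  | before (u v : PV ⊕ Y)
  | offset (v : PV ⊕ Y) (x : PV) (k : ℤ)
  | atEnd (x : PV) (k : ℕ)

/-- Guards of the Strand fragment: Boolean combinations of the atoms above. -/
inductive StrandGuard (PV Y : Type*) where
  | tru
  | atom (a : PosAtom PV Y)
  | not (g : StrandGuard PV Y)
  | and (g h : StrandGuard PV Y)
  | or (g h : StrandGuard PV Y)

/-- Index terms of the array property fragment: a universal variable (without arithmetic), or an
index expression `x + k`, `size + k` without universal variables. -/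
inductive IdxTerm (PV Y : Type*) where
  | univ (y : Y)
  | ptr (x : PV) (k : ℤ)
  | size (k : ℤ)

/-- Index guards of the array property fragment: positive combinations of `≤` and `=`. -/
inductive APFGuard (PV Y : Type*) where
  | tru
  | le (s t : IdxTerm PV Y)
  | eq (s t : IdxTerm PV Y)
  | and (g h : APFGuard PV Y)
  | or (g h : APFGuard PV Y)

/-- A conjunction of formulas `∀ Y, guard ⇒ ψ`, with `ψ` a data formula over the `d(y)`. -/
abbrev UnivFormula (G : Type*) (L : FirstOrder.Language) (Y : Type*) := List (G × L.Formula Y)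

section Semantics

variable {PV Y D : Type*} {aux : Finset PV} {nil : PV}

def PosAtom.Holds (c : Config D aux nil) (val : Y → c.Cell) : PosAtom PV Y → Prop
  | .before u v => c.pos val u < c.pos val v
  | .offset v x k => c.pos val v = c.pos val (.inl x) + k
  | .atEnd x k => c.pos val (.inl x) + k = c.size

def StrandGuard.Holds (c : Config D aux nil) (val : Y → c.Cell) : StrandGuard PV Y → Prop
  | .tru => True
  | .atom a => a.Holds c val
  | .not g => ¬ g.Holds c val
  | .and g h => g.Holds c val ∧ h.Holds c val
  | .or g h => g.Holds c val ∨ h.Holds c val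

def IdxTerm.value (c : Config D aux nil) (val : Y → c.Cell) : IdxTerm PV Y → ℤ
  | .univ y => c.pos val (.inr y)
  | .ptr x k => c.pos val (.inl x) + k
  | .size k => c.size + k

def APFGuard.Holds (c : Config D aux nil) (val : Y → c.Cell) : APFGuard PV Y → Prop
  | .tru => True
  | .le s t => s.value c val ≤ t.value c val
  | .eq s t => s.value c val = t.value c val
  | .and g h => g.Holds c val ∧ h.Holds c val
  | .or g h => g.Holds c val ∨ h.Holds c val

variable {L : FirstOrder.Language} [L.Structure D]

/-- `c ⊨ T` for a Strand formula; the universal variables range over all proper cells. -/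
def Config.ModelsStrand (c : Config D aux nil) (T : UnivFormula (StrandGuard PV Y) L Y) : Prop :=
  ∀ κ ∈ T, ∀ val : Y → c.Cell, κ.1.Holds c val → κ.2.Realize fun y => c.data (val y)

/-- `c ⊨ T` for an APF formula; the universal variables range over all proper cells. -/
def Config.ModelsAPF (c : Config D aux nil) (T : UnivFormula (APFGuard PV Y) L Y) : Prop :=
  ∀ κ ∈ T, ∀ val : Y → c.Cell, κ.1.Holds c val → κ.2.Realize fun y => c.data (val y)

end Semantics

/-! ### Simple paths and their structural constraints -/

namespace QDA

variable {PV Y F Q : Type*}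

/-- A simple path to an output state, given by its non-blank letters (`A` is deterministic): no
state is visited twice, and the last state is not labelled `false`. -/
def IsOutputPath [SemilatticeSup F] [BoundedOrder F] (A : QDA PV Y F Q)
    (p : List (Letter PV Y)) : Prop :=
  (∀ a ∈ p, a ≠ blank) ∧ Set.InjOn (fun i => A.run (p.take i)) (Set.Iic p.length) ∧
    ∃ q, A.run p = some q ∧ A.out q ≠ ⊥

theorem finite_outputPaths [SemilatticeSup F] [BoundedOrder F] [Finite PV] [Finite Y] [Finite Q]
    (A : QDA PV Y F Q) : {p | A.IsOutputPath p}.Finite := by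
  classical
  have := Fintype.ofFinite Q
  refine (List.finite_length_lt (Letter PV Y) (Fintype.card (Option Q))).subset ?_
  rintro p ⟨-, h, -⟩
  have h' : Set.InjOn (fun i => A.run (p.take i)) (Finset.Iic p.length : Finset ℕ) := by
    simpa using h
  have := Finset.card_le_card_of_injOn (t := Finset.univ) _ (fun _ _ => Finset.mem_univ _) h'
  simp at this
  simp
  omega

/-- The list of all simple paths to output states. -/
noncomputable def outputPaths [SemilatticeSup F] [BoundedOrder F] [Finite PV] [Finite Y] [Finite Q]
    (A : QDA PV Y F Q) : List (List (Letter PV Y)) :=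
  A.finite_outputPaths.toFinset.toList

/-- The `i`-th state of the path `p` has a self-loop on the blank letter. -/
def HasLoop (A : QDA PV Y F Q) (p : List (Letter PV Y)) (i : ℕ) : Prop :=
  ∃ q, A.run (p.take i) = some q ∧ A.δ q blank = some q

/-- The self-loop at the `i`-th state of `p` is irrelevant on `p`. -/
inductive Irrelevant (A : QDA PV Y F Q) (p : List (Letter PV Y)) : ℕ → Prop
  | rightBase {i : ℕ} {y : Y} (h : p[i]? = some (∅, some y)) (hl : A.HasLoop p (i + 1))
      (hn : ¬ A.HasLoop p i) : Irrelevant A p (i + 1)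
  | rightStep {i : ℕ} {y : Y} (h : p[i]? = some (∅, some y)) (hl : A.HasLoop p (i + 1))
      (hi : Irrelevant A p i) : Irrelevant A p (i + 1)
  | leftBase {i : ℕ} {y : Y} (h : p[i]? = some (∅, some y)) (hl : A.HasLoop p i)
      (hn : ¬ A.HasLoop p (i + 1)) : Irrelevant A p i
  | leftStep {i : ℕ} {y : Y} (h : p[i]? = some (∅, some y)) (hl : A.HasLoop p i)
      (hi : Irrelevant A p (i + 1)) : Irrelevant A p i

/-- The `i`-th state of `p` has a self-loop that is kept (irrelevant loops are stripped). -/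
def RelevantLoop (A : QDA PV Y F Q) (p : List (Letter PV Y)) (i : ℕ) : Prop :=
  A.HasLoop p i ∧ ¬ A.Irrelevant p i

end QDA

/-- `v` is one of the variables on the letter `a`. -/
def Letter.Has {PV Y : Type*} (a : Letter PV Y) : PV ⊕ Y → Prop
  | .inl x => x ∈ a.1
  | .inr y => a.2 = some y

/-- `v` is a pointer on the letter `a`, or `a` is `(b, y)` and `v` is `y`. -/
def Letter.Rep {PV Y : Type*} (a : Letter PV Y) : PV ⊕ Y → Prop
  | .inl x => x ∈ a.1
  | .inr y => a = (∅, some y)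

namespace QDA

variable {PV Y F Q : Type*}

/-- The conjuncts of the structural constraint of the path `p`. The `i`-th state of `p` lies between
letters `i - 1` and `i`.
* Across a state with a self-loop, the variables are related by `<`.
* A pointer `x` and a variable `v` with no self-loop between their letters are at a fixed distance
  (in particular: equality on one letter, successor on adjacent letters).
* If there is no self-loop from `x` up to the last state, the structure ends at a fixed distance. -/
inductive PathAtom (A : QDA PV Y F Q) (p : List (Letter PV Y)) : PosAtom PV Y → Prop
  | before {i : ℕ} {a b : Letter PV Y} {u v : PV ⊕ Y} (ha : p[i]? = some a)
      (hb : p[i + 1]? = some b) (hl : A.RelevantLoop p (i + 1)) (hu : a.Rep u) (hv : b.Rep v) :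
      PathAtom A p (.before u v)
  | offset {i j : ℕ} {a b : Letter PV Y} {x : PV} {v : PV ⊕ Y} (ha : p[i]? = some a)
      (hb : p[j]? = some b) (hl : ∀ m, min i j < m → m ≤ max i j → ¬ A.RelevantLoop p m)
      (hx : x ∈ a.1) (hv : b.Has v) : PathAtom A p (.offset v x ((j : ℤ) - (i : ℤ)))
  | atEnd {i : ℕ} {a : Letter PV Y} {x : PV} (ha : p[i]? = some a)
      (hl : ∀ m, i < m → m ≤ p.length → ¬ A.RelevantLoop p m) (hx : x ∈ a.1) :
      PathAtom A p (.atEnd x (p.length - i))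

theorem finite_pathAtoms [Finite PV] [Finite Y] (A : QDA PV Y F Q) (p : List (Letter PV Y)) :
    {a | A.PathAtom p a}.Finite := by
  have h1 := Set.finite_range fun t : (PV ⊕ Y) × (PV ⊕ Y) => PosAtom.before t.1 t.2
  have h2 := Set.finite_range fun t : (PV ⊕ Y) × PV × Fin p.length × Fin p.length =>
    PosAtom.offset t.1 t.2.1 ((t.2.2.2 : ℕ) - (t.2.2.1 : ℕ) : ℤ)
  have h3 := Set.finite_range fun t : PV × Fin p.length =>
    (PosAtom.atEnd t.1 (p.length - (t.2 : ℕ)) : PosAtom PV Y)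
  refine ((h1.union h2).union h3).subset ?_
  rintro _ (@⟨i, a, b, u, v, ha, hb, -, -, -⟩ | @⟨i, j, a, b, x, v, ha, hb, -, -, -⟩ |
    @⟨i, a, x, ha, -, -⟩)
  · exact Or.inl (Or.inl ⟨(u, v), rfl⟩)
  · obtain ⟨hi, -⟩ := List.getElem?_eq_some_iff.1 ha
    obtain ⟨hj, -⟩ := List.getElem?_eq_some_iff.1 hb
    exact Or.inl (Or.inr ⟨(v, x, ⟨i, hi⟩, ⟨j, hj⟩), rfl⟩)
  · obtain ⟨hi, -⟩ := List.getElem?_eq_some_iff.1 ha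
    exact Or.inr ⟨(x, ⟨i, hi⟩), rfl⟩

/-- The list of conjuncts of the structural constraint of `p`. -/
noncomputable def pathAtoms [Finite PV] [Finite Y] (A : QDA PV Y F Q) (p : List (Letter PV Y)) :
    List (PosAtom PV Y) :=
  (A.finite_pathAtoms p).toFinset.toList

end QDA

/-! ### The translation to Strand -/

namespace StrandGuard

variable {PV Y : Type*}

def conj (l : List (StrandGuard PV Y)) : StrandGuard PV Y := l.foldr .and .tru

def disj (l : List (StrandGuard PV Y)) : StrandGuard PV Y := l.foldr .or (.not .tru)

end StrandGuard

/-- All ordered pairs of distinct universal variables. -/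
noncomputable def univPairs (Y : Type*) [Fintype Y] : List (Y × Y) := by
  classical exact (Finset.univ.filter fun t : Y × Y => t.1 ≠ t.2).toList

/-- The universal variables are at pairwise distinct positions. -/
noncomputable def StrandGuard.distinct (PV Y : Type*) [Fintype Y] : StrandGuard PV Y :=
  .conj ((univPairs Y).map fun t =>
    .or (.atom (.before (.inr t.1) (.inr t.2))) (.atom (.before (.inr t.2) (.inr t.1))))

namespace QDA

variable {PV Y F Q : Type*} {L : FirstOrder.Language} {D : Type*} [L.Structure D]
  [SemilatticeSup F] [BoundedOrder F] [Finite PV] [Fintype Y] [Finite Q]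

/-- The structural constraint `φ_p`. -/
noncomputable def strandGuard (A : QDA PV Y F Q) (p : List (Letter PV Y)) : StrandGuard PV Y :=
  .conj ((A.pathAtoms p).map .atom)

/-- The formula at the last state of `p`. -/
def pathFormula (A : QDA PV Y F Q) (Φ : FormulaLattice L D Y F) (p : List (Letter PV Y)) :
    L.Formula Y :=
  match A.run p with
  | some q => Φ.formula (A.out q)
  | none => ⊥

/-- The Strand translation `⋀_p (∀ Y, φ_p ⇒ f(q_p)) ∧ (∀ Y, ¬ ⋁_p φ_p ⇒ false)`, where in the last
conjunct the universal variables are at pairwise distinct positions, as in valuation words. -/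
noncomputable def toStrand (A : QDA PV Y F Q) (Φ : FormulaLattice L D Y F) :
    UnivFormula (StrandGuard PV Y) L Y :=
  A.outputPaths.map (fun p => (A.strandGuard p, A.pathFormula Φ p)) ++
    [(.and (.distinct PV Y) (.not (.disj (A.outputPaths.map A.strandGuard))), ⊥)]

end QDA

/-! ### The translation to the array property fragment -/

namespace APFGuard

variable {PV Y : Type*}

def conj (l : List (APFGuard PV Y)) : APFGuard PV Y := l.foldr .and .tru

/-- An unsatisfiable guard (`size + 1 ≤ size`). -/
def fls : APFGuard PV Y := .le (.size 1) (.size 0)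

def disj (l : List (APFGuard PV Y)) : APFGuard PV Y := l.foldr .or fls

end APFGuard

/-- A pointer or universal variable as an index term. -/
def IdxTerm.ofVar {PV Y : Type*} : PV ⊕ Y → IdxTerm PV Y
  | .inl x => .ptr x 0
  | .inr y => .univ y

namespace PosAtom

variable {PV Y : Type*}

/-- The atom as an index guard; `<` between two universal variables is relaxed to `≤`. -/
def toAPF : PosAtom PV Y → APFGuard PV Y
  | .before (.inl x) v => .le (.ptr x 1) (.ofVar v)
  | .before (.inr y) (.inl x) => .le (.univ y) (.ptr x (-1))
  | .before (.inr y) (.inr z) => .le (.univ y) (.univ z)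
  | .offset v x k => .eq (.ofVar v) (.ptr x k)
  | .atEnd x k => .eq (.ptr x k) (.size 0)

/-- The negated atom as an index guard; there is none if the atom relates two universal variables. -/
def negAPF : PosAtom PV Y → Option (APFGuard PV Y)
  | .before (.inr _) (.inr _) => none
  | .before u v => some (.le (.ofVar v) (.ofVar u))
  | .offset v x k => some (.or (.le (.ofVar v) (.ptr x (k - 1))) (.le (.ptr x (k + 1)) (.ofVar v)))
  | .atEnd x k => some (.or (.le (.ptr x k) (.size (-1))) (.le (.size 1) (.ptr x k)))

/-- The pair of universal variables whose relation `<` is relaxed to `≤`, if any. -/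
def relaxedPair : PosAtom PV Y → Option (Y × Y)
  | .before (.inr y) (.inr z) => some (y, z)
  | _ => none

end PosAtom

/-- The data formula `⋁ d(y) = d(z)` over the pairs `(y, z)` in a list. -/
def dataEqs (L : FirstOrder.Language) {Y : Type*} (l : List (Y × Y)) : L.Formula Y :=
  (l.map fun t => (FirstOrder.Language.Term.equal (.var t.1) (.var t.2) : L.Formula Y)).foldr
    (· ⊔ ·) ⊥

namespace QDA

variable {PV Y F Q : Type*} {L : FirstOrder.Language} {D : Type*} [L.Structure D]
  [SemilatticeSup F] [BoundedOrder F] [Finite PV] [Fintype Y] [Finite Q]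

/-- The relaxed structural constraint of the path `p`. -/
noncomputable def apfGuard (A : QDA PV Y F Q) (p : List (Letter PV Y)) : APFGuard PV Y :=
  .conj ((A.pathAtoms p).map PosAtom.toAPF)

/-- `¬ ⋁_p φ_p` with the negations of relations between two universal variables removed. -/
noncomputable def apfExitGuard (A : QDA PV Y F Q) : APFGuard PV Y :=
  .conj (A.outputPaths.map fun p => .disj ((A.pathAtoms p).filterMap PosAtom.negAPF))

/-- The APF translation. The formula of each path is weakened by `d(y) = d(z)` for every relation
`y < z` relaxed to `y ≤ z`. In the last conjunct, distinctness of the universal variables, which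
APF cannot express in a guard, is likewise replaced by weakening the conclusion `false` with
`d(y) = d(z)` for all pairs `y ≠ z`. -/
noncomputable def toAPF (A : QDA PV Y F Q) (Φ : FormulaLattice L D Y F) :
    UnivFormula (APFGuard PV Y) L Y :=
  A.outputPaths.map (fun p => (A.apfGuard p,
      A.pathFormula Φ p ⊔ dataEqs L ((A.pathAtoms p).filterMap PosAtom.relaxedPair))) ++
    [(A.apfExitGuard, dataEqs L (univPairs Y))]

end QDA

/-! ### Words and their non-blank letters -/

/-! The data only enter through the output formula of the last state, so the heart of the matter
concerns symbolic words: how far `φ_p` describes the configurations whose word runs along `p`.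

`φ_p` suffices (`run_eq_of_pathAtoms`). Relevance of loops is the same on both sides of a lone
universal variable (`relevantLoop_iff_succ`). A state without relevant loop can therefore be traced
back through such letters to a pointer, at worst to `nil` at the first cell (`exists_anchor`).
Distances from that pointer force the letters around the state onto adjacent cells. Wherever letters
may be apart there is a self-loop that reads the blanks between them. Hence the word of the
configuration ends in the same state as `p`.

Some `φ_p` is necessary (`exists_outputPath_of_mem_language`). As blanks are self-loops, the
non-blank letters of an accepted valuation word form a path to the same state. It is simple: cutting
out a cycle would lose a variable, and an invalid input would reach an output other than `false`.
The delicate point is that stripped loops are never used. Exchanging a blank with an adjacent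
universal variable gives another valuation word of the same data word, which must be accepted too; a
blank at an irrelevant loop could be moved in this way to a state without loop
(`Elastic.not_gap_of_irrelevant`). So all blanks are read at relevant loops, and `PathAtom.holds`
gives the constraint.

For Strand, the conjunct of `p` carries the output formula between run and configuration, and the
last conjunct is the existence of a suitable `p`. For APF, a relaxed guard only admits additional
valuations in which two variables share a cell, and then the added data equality holds; removing
disjuncts from the exit guard only strengthens it. Valuations at auxiliary cells are invisible to
the formulas, and in the converse `AuxTrue` accounts for them. -/

open Classical in
theorem List.existsUnique_get_iff_countP {α : Type*} (P : α → Prop) (l : List α) :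
    (∃! i : Fin l.length, P (l.get i)) ↔ l.countP (fun a => decide (P a)) = 1 := by
  induction l with
  | nil =>
    simp only [List.countP_nil, zero_ne_one, iff_false]
    rintro ⟨i, -⟩
    exact i.elim0
  | cons a l ih =>
    by_cases ha : P a
    · rw [List.countP_cons_of_pos (by simpa using ha), Nat.add_eq_right, List.countP_eq_zero]
      constructor
      · rintro ⟨i, -, hi⟩ b hb
        obtain ⟨k, hk, rfl⟩ := List.getElem_of_mem hb
        simp only [decide_eq_true_eq]
        intro hP
        have h0 := hi ⟨0, by simp⟩ ha
        have h1 := hi ⟨k + 1, by simpa using hk⟩ (by simpa using hP)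
        simpa using h0.trans h1.symm
      · intro h
        refine ⟨⟨0, by simp⟩, ha, ?_⟩
        rintro ⟨i, hi⟩ hP
        cases i with
        | zero => rfl
        | succ i =>
          have := h _ (List.getElem_mem (by simpa using hi : i < l.length))
          simp at this
          exact absurd (by simpa using hP) this
    · rw [List.countP_cons_of_neg (by simpa using ha), ← ih]
      constructor
      · rintro ⟨⟨i, hi⟩, hP, hu⟩
        cases i with
        | zero => exact absurd hP ha
        | succ i =>
          refine ⟨⟨i, by simpa using hi⟩, by simpa using hP, ?_⟩
          rintro ⟨j, hj⟩ hPj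
          have := hu ⟨j + 1, by simpa using hj⟩ (by simpa using hPj)
          simpa using this
      · rintro ⟨⟨i, hi⟩, hP, hu⟩
        refine ⟨⟨i + 1, by simpa using hi⟩, by simpa using hP, ?_⟩
        rintro ⟨j, hj⟩ hPj
        cases j with
        | zero => exact absurd hPj ha
        | succ j =>
          have := hu ⟨j, by simpa using hj⟩ (by simpa using hPj)
          simpa using this

section Words

variable {PV Y : Type*}

theorem Letter.Rep.has {a : Letter PV Y} {v : PV ⊕ Y} (h : a.Rep v) : a.Has v := by
  cases v with
  | inl x => exact h
  | inr y => simp only [Letter.Rep] at h; simp [Letter.Has, h]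

theorem Letter.not_has_blank (v : PV ⊕ Y) : ¬ (blank : Letter PV Y).Has v := by
  cases v <;> simp [Letter.Has, blank]

theorem Letter.Has.ne_blank {a : Letter PV Y} {v : PV ⊕ Y} (h : a.Has v) : a ≠ blank := by
  rintro rfl
  exact Letter.not_has_blank v h

theorem Letter.exists_rep {a : Letter PV Y} (h : a ≠ blank) : ∃ v, a.Rep v := by
  obtain ⟨s, o⟩ := a
  by_cases hs : s = ∅
  · subst hs
    cases o with
    | none => exact absurd rfl h
    | some y => exact ⟨.inr y, rfl⟩
  · obtain ⟨x, hx⟩ := Finset.nonempty_iff_ne_empty.2 hs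
    exact ⟨.inl x, hx⟩

theorem Letter.eq_of_has_iff {a b : Letter PV Y} (h : ∀ v, a.Has v ↔ b.Has v) : a = b := by
  refine Prod.ext (Finset.ext fun x => h (.inl x)) (Option.ext fun y => h (.inr y))

-- Counting makes validity easy to transport: counts are additive under concatenation, invariant
-- under permutation, and unchanged when blanks are filtered out.
open Classical in
theorem validSymbolic_iff_countP (u : List (Letter PV Y)) :
    ValidSymbolic u ↔ ∀ v, u.countP (fun a => decide (a.Has v)) = 1 := by
  unfold ValidSymbolic
  rw [Sum.forall]
  refine and_congr (forall_congr' fun x => ?_) (forall_congr' fun y => ?_)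
  · exact List.existsUnique_get_iff_countP (fun a : Letter PV Y => a.Has (.inl x)) u
  · exact List.existsUnique_get_iff_countP (fun a : Letter PV Y => a.Has (.inr y)) u

theorem ValidSymbolic.existsUnique {u : List (Letter PV Y)} (h : ValidSymbolic u) (v : PV ⊕ Y) :
    ∃! i : Fin u.length, (u.get i).Has v := by
  cases v with
  | inl x => exact h.1 x
  | inr y => exact h.2 y

theorem ValidSymbolic.exists_getElem? {u : List (Letter PV Y)} (h : ValidSymbolic u)
    (v : PV ⊕ Y) : ∃ (i : ℕ) (a : Letter PV Y), u[i]? = some a ∧ a.Has v := by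
  obtain ⟨i, hi, -⟩ := h.existsUnique v
  exact ⟨i, u.get i, by simp, hi⟩

theorem ValidSymbolic.index_eq {u : List (Letter PV Y)} (h : ValidSymbolic u)
    {v : PV ⊕ Y} {i j : ℕ} {a b : Letter PV Y} (hi : u[i]? = some a) (hj : u[j]? = some b)
    (ha : a.Has v) (hb : b.Has v) : i = j := by
  obtain ⟨hi', rfl⟩ := List.getElem?_eq_some_iff.1 hi
  obtain ⟨hj', rfl⟩ := List.getElem?_eq_some_iff.1 hj
  have := (h.existsUnique v).unique (y₁ := ⟨i, hi'⟩) (y₂ := ⟨j, hj'⟩) ha hb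
  simpa using this

open Classical in
theorem ValidSymbolic.perm {u u' : List (Letter PV Y)} (h : ValidSymbolic u) (hp : u.Perm u') :
    ValidSymbolic u' := by
  rw [validSymbolic_iff_countP] at h ⊢
  exact fun v => (hp.countP_eq _).symm.trans (h v)

/-- Cutting out a factor that contains a variable makes a valid word invalid. -/
theorem ValidSymbolic.not_cut {α β γ : List (Letter PV Y)} (h : ValidSymbolic (α ++ β ++ γ))
    {a : Letter PV Y} (ha : a ∈ β) (hab : a ≠ blank) : ¬ ValidSymbolic (α ++ γ) := by
  classical
  obtain ⟨v, hv⟩ := Letter.exists_rep hab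
  rw [validSymbolic_iff_countP] at h ⊢
  intro h'
  have h1 := h v
  have h2 := h' v
  simp only [List.countP_append] at h1 h2
  have h3 : 0 < β.countP (fun a => decide (a.Has v)) :=
    List.countP_pos_iff.2 ⟨a, ha, by simpa using hv.has⟩
  omega

open Classical in
/-- The non-blank letters of a word. -/
noncomputable def nonblank (u : List (Letter PV Y)) : List (Letter PV Y) :=
  u.filter fun a => decide (a ≠ blank)

@[simp] theorem nonblank_nil : nonblank ([] : List (Letter PV Y)) = [] := by simp [nonblank]

@[simp] theorem nonblank_append (u v : List (Letter PV Y)) :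
    nonblank (u ++ v) = nonblank u ++ nonblank v := by simp [nonblank]

@[simp] theorem nonblank_cons_blank (u : List (Letter PV Y)) :
    nonblank (blank :: u) = nonblank u := by simp [nonblank]

theorem nonblank_cons {a : Letter PV Y} (h : a ≠ blank) (u : List (Letter PV Y)) :
    nonblank (a :: u) = a :: nonblank u := by simp [nonblank, h]

@[simp] theorem nonblank_cons_univ (y : Y) (u : List (Letter PV Y)) :
    nonblank ((∅, some y) :: u) = (∅, some y) :: nonblank u :=
  nonblank_cons (by simp [blank]) u

@[simp] theorem nonblank_replicate (k : ℕ) :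
    nonblank (List.replicate k (blank : Letter PV Y)) = [] := by simp [nonblank]

theorem ne_blank_of_mem_nonblank {u : List (Letter PV Y)} {a : Letter PV Y}
    (h : a ∈ nonblank u) : a ≠ blank := by
  simpa using (List.mem_filter.1 h).2

theorem ValidSymbolic.nonblank {u : List (Letter PV Y)} (h : ValidSymbolic u) :
    ValidSymbolic (nonblank u) := by
  classical
  rw [validSymbolic_iff_countP] at h ⊢
  intro v
  rw [← h v, _root_.nonblank, List.countP_filter]
  refine List.countP_congr fun a _ => ?_
  simpa using fun h => Letter.Has.ne_blank h

theorem nonblank_head {u : List (Letter PV Y)} {a : Letter PV Y}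
    (h : (nonblank u)[0]? = some a) : ∃ k u', u = List.replicate k blank ++ a :: u' := by
  induction u with
  | nil => simp at h
  | cons b u ih =>
    by_cases hb : b = blank
    · subst hb
      obtain ⟨k, u', rfl⟩ := ih (by simpa using h)
      exact ⟨k + 1, u', by simp [List.replicate_succ]⟩
    · rw [nonblank_cons hb] at h
      exact ⟨0, u, by simpa using h⟩

theorem nonblank_last {u : List (Letter PV Y)} {a : Letter PV Y} {i : ℕ}
    (hi : (nonblank u).length = i + 1) (h : (nonblank u)[i]? = some a) :
    ∃ k u', u = u' ++ a :: List.replicate k blank := by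
  induction u using List.reverseRecOn with
  | nil => simp at hi
  | append_singleton u b ih =>
    by_cases hb : b = blank
    · subst hb
      obtain ⟨k, u', rfl⟩ := ih (by simpa using hi) (by simpa using h)
      exact ⟨k + 1, u', by simp [List.replicate_succ']⟩
    · rw [nonblank_append, nonblank_cons hb] at h hi
      simp at hi
      subst hi
      refine ⟨0, u, ?_⟩
      simp at h
      simp [h]

/-- A blank of `u` is read after exactly `m` non-blank letters. -/
def Gap (u : List (Letter PV Y)) (m : ℕ) : Prop :=
  ∃ α β, u = α ++ blank :: β ∧ (nonblank α).length = m

/-- Only blanks separate the given blank from the next non-blank letter, so the last of them is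
adjacent to `y` and can take its place. The mirror image `Gap.exists_right` uses the first blank
after `y`. -/
theorem Gap.exists_left {u : List (Letter PV Y)} {i : ℕ} {y : Y} (h : Gap u i)
    (hy : (nonblank u)[i]? = some (∅, some y)) :
    ∃ α β, u = α ++ blank :: (∅, some y) :: β ∧ (nonblank α).length = i := by
  obtain ⟨α, β, rfl, rfl⟩ := h
  obtain ⟨k, β', rfl⟩ := nonblank_head (u := β) (a := (∅, some y))
    (by simpa [List.getElem?_append_right] using hy)
  refine ⟨α ++ List.replicate k blank, β', ?_, by simp⟩
  have : blank :: (List.replicate k blank ++ (∅, some y) :: β') =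
      List.replicate k blank ++ (blank : Letter PV Y) :: (∅, some y) :: β' := by
    rw [← List.cons_append, ← List.replicate_succ, List.replicate_succ', List.append_assoc]
    rfl
  rw [this, List.append_assoc]

theorem Gap.exists_right {u : List (Letter PV Y)} {i : ℕ} {y : Y} (h : Gap u (i + 1))
    (hy : (nonblank u)[i]? = some (∅, some y)) :
    ∃ α β, u = α ++ (∅, some y) :: blank :: β ∧ (nonblank α).length = i := by
  obtain ⟨α, β, rfl, hα⟩ := h
  rw [nonblank_append, List.getElem?_append_left (by omega)] at hy
  obtain ⟨k, α', rfl⟩ := nonblank_last hα hy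
  refine ⟨α', List.replicate k blank ++ β, ?_, by simpa using hα⟩
  have : List.replicate k blank ++ blank :: β =
      (blank : Letter PV Y) :: (List.replicate k blank ++ β) := by
    rw [← List.cons_append, ← List.replicate_succ, List.replicate_succ', List.append_assoc]
    rfl
  simp [this]

/-- The number of non-blank letters among the first `k` letters. -/
noncomputable def nonblankCount (u : List (Letter PV Y)) (k : ℕ) : ℕ :=
  (nonblank (u.take k)).length

theorem nonblankCount_succ {u : List (Letter PV Y)} {k : ℕ} {a : Letter PV Y}
    (h : u[k]? = some a) (ha : a ≠ blank) : nonblankCount u (k + 1) = nonblankCount u k + 1 := by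
  simp [nonblankCount, List.take_add_one, h, nonblank_cons ha]

theorem nonblankCount_mono (u : List (Letter PV Y)) : Monotone (nonblankCount u) := by
  classical
  intro k l h
  exact ((List.take_sublist_take_left h).filter _).length_le

theorem nonblankCount_length (u : List (Letter PV Y)) :
    nonblankCount u u.length = (nonblank u).length := by simp [nonblankCount]

theorem nonblank_getElem? {u : List (Letter PV Y)} {k : ℕ} {a : Letter PV Y}
    (h : u[k]? = some a) (ha : a ≠ blank) : (nonblank u)[nonblankCount u k]? = some a := by
  obtain ⟨hk, rfl⟩ := List.getElem?_eq_some_iff.1 h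
  conv_lhs => rw [← List.take_append_drop k u, List.drop_eq_getElem_cons hk]
  rw [nonblank_append, nonblank_cons ha]
  simp only [nonblankCount, List.take_append_drop, ← List.drop_eq_getElem_cons hk]
  simp

theorem gap_of_getElem? {u : List (Letter PV Y)} {k : ℕ} (h : u[k]? = some blank) :
    Gap u (nonblankCount u k) := by
  obtain ⟨hk, hb⟩ := List.getElem?_eq_some_iff.1 h
  refine ⟨u.take k, u.drop (k + 1), ?_, rfl⟩
  rw [← hb, ← List.drop_eq_getElem_cons hk, List.take_append_drop]

/-- With no gap in this range every letter from `k` up to `l` is non-blank, so position in the word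
and index on the path grow in step. This is the source of the fixed distances. -/
theorem nonblankCount_eq_add {u : List (Letter PV Y)} {k l : ℕ} {a : Letter PV Y} (hkl : k < l)
    (hl : l ≤ u.length) (hk : u[k]? = some a) (ha : a ≠ blank)
    (hg : ∀ m, nonblankCount u k < m → m ≤ nonblankCount u l → ¬ Gap u m) :
    nonblankCount u l = nonblankCount u k + (l - k) := by
  induction l, hkl using Nat.le_induction with
  | base => rw [nonblankCount_succ hk ha]; omega
  | succ l hkl ih =>
    have hb : u[l]? = some u[l] := List.getElem?_eq_getElem hl
    have h1 := nonblankCount_mono u hkl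
    rw [Nat.succ_eq_add_one, nonblankCount_succ hk ha] at h1
    have h2 := nonblankCount_mono u (Nat.le_succ l)
    have := ih (by omega) fun m hm hm' => hg m hm (hm'.trans h2)
    by_cases hbl : u[l] = blank
    · rw [hbl] at hb
      exact absurd (gap_of_getElem? hb) (hg _ (by omega) h2)
    · rw [nonblankCount_succ hb hbl]
      omega

end Words

/-! ### Erasing the data of valuation words -/

section Words

variable {PV Y D : Type*}

/-- The letters of a word over `Σ × D × (Y ∪ {-})` without the data. -/
def toSymbolic (v : List (Finset PV × D × Option Y)) : List (Letter PV Y) :=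
  v.map fun a => (a.1, a.2.2)

theorem isValuationWord_iff (v : List (Finset PV × D × Option Y)) :
    IsValuationWord v ↔ ValidSymbolic (toSymbolic v) := by
  classical
  unfold IsValuationWord IsDataWord ValidSymbolic
  refine and_congr (forall_congr' fun x => ?_) (forall_congr' fun y => ?_)
  · rw [List.existsUnique_get_iff_countP (fun a : Finset PV × D => x ∈ a.1),
      List.existsUnique_get_iff_countP (fun a : Letter PV Y => x ∈ a.1), toDataWord, toSymbolic,
      List.countP_map, List.countP_map]
    rfl
  · rw [List.existsUnique_get_iff_countP (fun a : Finset PV × D × Option Y => a.2.2 = some y),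
      List.existsUnique_get_iff_countP (fun a : Letter PV Y => a.2 = some y), toSymbolic,
      List.countP_map]
    rfl

end Words

/-! ### Runs of elastic automata and their paths -/

namespace QDA

section Runs

variable {PV Y F Q : Type*} (A : QDA PV Y F Q)

theorem runFrom_append (q : Q) (u v : List (Letter PV Y)) :
    A.runFrom q (u ++ v) = (A.runFrom q u).bind fun q' => A.runFrom q' v := by
  induction u generalizing q with
  | nil => rfl
  | cons a u ih =>
    simp only [List.cons_append, runFrom]
    cases A.δ q a <;> simp [ih]

theorem run_append (u v : List (Letter PV Y)) :
    A.run (u ++ v) = (A.run u).bind fun q => A.runFrom q v :=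
  A.runFrom_append _ u v

theorem run_take_succ {u : List (Letter PV Y)} {k : ℕ} {a : Letter PV Y} (h : u[k]? = some a) :
    A.run (u.take (k + 1)) = (A.run (u.take k)).bind fun q => A.δ q a := by
  rw [List.take_add_one, h, run_append]
  congr 1
  funext q
  simp only [Option.toList_some, runFrom]
  cases A.δ q a <;> rfl

variable {A}

theorem Elastic.runFrom_nonblank (hE : A.Elastic) {q q' : Q} {u : List (Letter PV Y)}
    (h : A.runFrom q u = some q') : A.runFrom q (nonblank u) = some q' := by
  induction u generalizing q with
  | nil => simpa using h
  | cons a u ih =>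
    simp only [runFrom, Option.bind_eq_some_iff] at h
    obtain ⟨q₁, h1, h2⟩ := h
    by_cases ha : a = blank
    · subst ha
      rw [nonblank_cons_blank]
      have := hE q q₁ h1
      subst this
      exact ih h2
    · rw [nonblank_cons ha]
      simp [runFrom, h1, ih h2]

theorem Elastic.run_nonblank (hE : A.Elastic) {q : Q} {u : List (Letter PV Y)}
    (h : A.run u = some q) : A.run (nonblank u) = some q :=
  hE.runFrom_nonblank h

/-- The blank of the gap is read at the state reached by its prefix, and deleting the blanks of the
prefix does not change that state. -/
theorem Elastic.hasLoop_of_gap (hE : A.Elastic) {q : Q} {u : List (Letter PV Y)} {m : ℕ}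
    (h : A.run u = some q) (hg : Gap u m) : A.HasLoop (nonblank u) m := by
  obtain ⟨α, β, rfl, rfl⟩ := hg
  simp only [run_append, runFrom, Option.bind_eq_some_iff] at h
  obtain ⟨q₁, h1, q₂, h2, -⟩ := h
  have := hE _ _ h2
  subst this
  refine ⟨q₁, ?_, h2⟩
  rw [nonblank_append, List.take_left]
  exact hE.run_nonblank h1

/-- If every word of a family closed under exchanging a blank with an adjacent universal variable
has a run, then no word of the family uses a self-loop that is irrelevant on its path. -/
theorem Elastic.not_gap_of_irrelevant (hE : A.Elastic) {W : Set (List (Letter PV Y))}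
    (hrun : ∀ u ∈ W, ∃ q, A.run u = some q)
    (hswap : ∀ α β y, α ++ blank :: (∅, some y) :: β ∈ W ↔ α ++ (∅, some y) :: blank :: β ∈ W)
    {p : List (Letter PV Y)} {m : ℕ} (h : A.Irrelevant p m) :
    ∀ u ∈ W, nonblank u = p → ¬ Gap u m := by
  have left : ∀ {i : ℕ} {y : Y}, p[i]? = some (∅, some y) → ∀ u ∈ W, nonblank u = p → Gap u i →
      ∃ u' ∈ W, nonblank u' = p ∧ Gap u' (i + 1) := by
    rintro i y hy u hu rfl hg
    obtain ⟨α, β, rfl, rfl⟩ := hg.exists_left hy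
    exact ⟨_, (hswap α β y).1 hu, by simp, α ++ [(∅, some y)], β, by simp, by simp⟩
  have right : ∀ {i : ℕ} {y : Y}, p[i]? = some (∅, some y) → ∀ u ∈ W, nonblank u = p →
      Gap u (i + 1) → ∃ u' ∈ W, nonblank u' = p ∧ Gap u' i := by
    rintro i y hy u hu rfl hg
    obtain ⟨α, β, rfl, rfl⟩ := hg.exists_right hy
    exact ⟨_, (hswap α β y).2 hu, by simp, α, (∅, some y) :: β, rfl, rfl⟩
  have loop : ∀ {i : ℕ}, ∀ u ∈ W, nonblank u = p → Gap u i → A.HasLoop p i := by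
    rintro i u hu rfl hg
    obtain ⟨q, hq⟩ := hrun u hu
    exact hE.hasLoop_of_gap hq hg
  -- Moving the blank across `y` puts it at the neighbouring state. In the base cases that state has
  -- no loop to read it; in the step cases its loop is already known to be unused.
  induction h with
  | rightBase hy _ hn =>
    intro u hu hp hg
    obtain ⟨u', hu', hp', hg'⟩ := right hy u hu hp hg
    exact hn (loop u' hu' hp' hg')
  | rightStep hy _ _ ih =>
    intro u hu hp hg
    obtain ⟨u', hu', hp', hg'⟩ := right hy u hu hp hg
    exact ih u' hu' hp' hg'
  | leftBase hy _ hn =>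
    intro u hu hp hg
    obtain ⟨u', hu', hp', hg'⟩ := left hy u hu hp hg
    exact hn (loop u' hu' hp' hg')
  | leftStep hy _ _ ih =>
    intro u hu hp hg
    obtain ⟨u', hu', hp', hg'⟩ := left hy u hu hp hg
    exact ih u' hu' hp' hg'

variable [SemilatticeSup F] [BoundedOrder F]

theorem ChecksInput.validSymbolic (hA : A.ChecksInput) {u : List (Letter PV Y)} {q : Q}
    (h : A.run u = some q) (hq : A.out q ≠ ⊥) : ValidSymbolic u := by
  by_contra hu
  exact hq (hA u hu q h)

/-- The path of a run that does not end in `false` is simple. -/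
theorem ChecksInput.isOutputPath (hA : A.ChecksInput) {p : List (Letter PV Y)} {q : Q}
    (hp : ∀ a ∈ p, a ≠ blank) (h : A.run p = some q) (hq : A.out q ≠ ⊥) : A.IsOutputPath p := by
  refine ⟨hp, ?_, q, h, hq⟩
  -- A repeated state would let the run skip the letters from `i` to `j`. The shortened word still
  -- reaches `q`, but lacks the variables on the skipped letters.
  have key : ∀ i j : ℕ, i < j → j ≤ p.length → A.run (p.take i) ≠ A.run (p.take j) := by
    intro i j hij hj heq
    have hrun : A.run (p.take i ++ p.drop j) = some q := by
      rw [run_append, heq, ← run_append, List.take_append_drop, h]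
    have hv := hA.validSymbolic hrun hq
    have hsplit : p = p.take i ++ (p.drop i).take (j - i) ++ p.drop j := by
      conv_lhs => rw [← List.take_append_drop j p]
      congr 1
      conv_lhs => rw [show j = i + (j - i) by omega, List.take_add]
    have hmem : p[i] ∈ (p.drop i).take (j - i) := by
      rw [List.mem_iff_getElem]
      exact ⟨0, by simp; omega, by simp⟩
    have hval := hA.validSymbolic h hq
    rw [hsplit] at hval
    exact hval.not_cut hmem (hp _ (List.getElem_mem _)) hv
  intro i hi j hj heq
  rcases lt_trichotomy i j with hij | hij | hij
  · exact absurd heq (key i j hij hj)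
  · exact hij
  · exact absurd heq.symm (key j i hij hi)

end Runs

/-! ### Registers and acceptance -/

section Registers

variable {PV Y F Q D : Type*} [DecidableEq Y]

/-- The registers after reading a word. -/
def registers (r : Y → Option D) (v : List (Finset PV × D × Option Y)) : Y → Option D :=
  v.foldl (fun r a => match a.2.2 with
    | some y => Function.update r y (some a.2.1)
    | none => r) r

/-- Transitions never inspect the registers, so control and data can be computed separately. -/
theorem steps_eq (A : QDA PV Y F Q) (q : Q) (r : Y → Option D)
    (v : List (Finset PV × D × Option Y)) :
    A.steps (q, r) v = (A.runFrom q (toSymbolic v)).map fun q' => (q', registers r v) := by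
  induction v generalizing q r with
  | nil => rfl
  | cons a v ih =>
    simp only [steps, step, toSymbolic, List.map_cons, runFrom]
    cases A.δ q (a.1, a.2.2) with
    | none => rfl
    | some q' =>
      simp only [Option.map_some, Option.bind_some]
      rw [ih]
      rfl

/-- The disjunction is the induction invariant: the value of `y` is already stored or still to be
read. By `hs` a later write to `y` stores the same value. -/
theorem registers_eq {s : Y → D} {v : List (Finset PV × D × Option Y)}
    (hs : ∀ a ∈ v, ∀ y, a.2.2 = some y → a.2.1 = s y) {y : Y} {r : Y → Option D}
    (h : r y = some (s y) ∨ ∃ a ∈ v, a.2.2 = some y) : registers r v y = some (s y) := by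
  induction v generalizing r with
  | nil => simpa [registers] using h
  | cons a v ih =>
    simp only [registers, List.foldl_cons]
    refine ih (fun a' ha' => hs a' (List.mem_cons_of_mem _ ha')) ?_
    have ha := hs a List.mem_cons_self
    rcases hz : a.2.2 with _ | z
    · rcases h with h | ⟨b, hb, hby⟩
      · exact Or.inl h
      · rcases List.mem_cons.1 hb with rfl | hb
        · rw [hz] at hby
          cases hby
        · exact Or.inr ⟨b, hb, hby⟩
    · by_cases hzy : y = z
      · subst hzy
        exact Or.inl (by simp [ha y hz])
      · simp only [Function.update_of_ne hzy]
        rcases h with h | ⟨b, hb, hby⟩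
        · exact Or.inl h
        · rcases List.mem_cons.1 hb with rfl | hb
          · rw [hz] at hby
            exact absurd (Option.some.inj hby).symm hzy
          · exact Or.inr ⟨b, hb, hby⟩

variable {L : FirstOrder.Language} [L.Structure D] [SemilatticeSup F] [BoundedOrder F]

theorem acceptsValuation_iff (A : QDA PV Y F Q) (Φ : FormulaLattice L D Y F)
    {v : List (Finset PV × D × Option Y)} (hv : IsValuationWord v) {s : Y → D}
    (hs : ∀ a ∈ v, ∀ y, a.2.2 = some y → a.2.1 = s y) :
    A.AcceptsValuation Φ v ↔
      ∃ q, A.run (toSymbolic v) = some q ∧ (Φ.formula (A.out q)).Realize s := by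
  have hreg : ∀ y, registers (fun _ => none) v y = some (s y) := fun y => by
    obtain ⟨i, hi, -⟩ := hv.2 y
    exact registers_eq hs (Or.inr ⟨_, List.get_mem v i, hi⟩)
  simp only [AcceptsValuation, steps_eq, Option.map_eq_some_iff, Prod.mk.injEq]
  constructor
  · rintro ⟨q, r, s', ⟨q', h1, rfl, rfl⟩, h2, h3⟩
    have : s' = s := funext fun y => by simpa [hreg] using (h2 y).symm
    subst this
    exact ⟨q', h1, h3⟩
  · rintro ⟨q, h1, h2⟩
    exact ⟨q, _, s, ⟨q, h1, rfl, rfl⟩, hreg, h2⟩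

end Registers

end QDA

/-! ### Structural constraints and positions -/

section Positions

variable {PV Y D : Type*} {aux : Finset PV} {nil : PV}

theorem Config.pos_nonneg (c : Config D aux nil) (val : Y → c.Cell) (v : PV ⊕ Y) :
    0 ≤ c.pos val v := by
  cases v <;> simp [Config.pos]

theorem Config.pos_lt (c : Config D aux nil) (val : Y → c.Cell) (v : PV ⊕ Y) :
    c.pos val v < c.size := by
  cases v <;> simp [Config.pos]

theorem Config.pos_nil (c : Config D aux nil) (val : Y → c.Cell) : c.pos val (.inl nil) = 0 := by
  simp [Config.pos, c.ptr_nil]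

/-- `u` is the symbolic word of the configuration `c` under the valuation `val`. -/
def Config.Spells (c : Config D aux nil) (val : Y → c.Cell) (u : List (Letter PV Y)) : Prop :=
  u.length = c.size ∧
    ∀ (k : ℕ) (a : Letter PV Y), u[k]? = some a → ∀ v, a.Has v ↔ c.pos val v = k

theorem Config.Spells.exists_index {c : Config D aux nil} {val : Y → c.Cell}
    {u : List (Letter PV Y)} (h : c.Spells val u) (v : PV ⊕ Y) :
    ∃ (k : ℕ) (a : Letter PV Y), u[k]? = some a ∧ a.Has v ∧ c.pos val v = k := by
  obtain ⟨k, hk⟩ := Int.eq_ofNat_of_zero_le (c.pos_nonneg val v)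
  have hlt : k < u.length := by
    have := c.pos_lt val v
    rw [h.1]
    omega
  exact ⟨k, u[k], List.getElem?_eq_getElem hlt,
    (h.2 k _ (List.getElem?_eq_getElem hlt) v).2 hk, hk⟩

end Positions

namespace QDA

section Positions

variable {PV Y F Q D : Type*} {A : QDA PV Y F Q} {aux : Finset PV} {nil : PV}
  {c : Config D aux nil} {val : Y → c.Cell}

/-- A word that only uses relevant self-loops satisfies the structural constraint of its path. -/
theorem PathAtom.holds {u : List (Letter PV Y)} (hu : c.Spells val u) (hv : ValidSymbolic u)
    (hg : ∀ m, Gap u m → A.RelevantLoop (nonblank u) m) {t : PosAtom PV Y}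
    (ht : A.PathAtom (nonblank u) t) : t.Holds c val := by
  -- Each variable occurs once on the path, so the index of its letter there is the number of
  -- non-blank letters before its cell.
  have key : ∀ {i : ℕ} {a : Letter PV Y} {v : PV ⊕ Y}, (nonblank u)[i]? = some a → a.Has v →
      ∃ (k : ℕ) (b : Letter PV Y), u[k]? = some b ∧ b ≠ blank ∧ c.pos val v = k ∧
        nonblankCount u k = i := by
    intro i a v ha hav
    obtain ⟨k, b, hb, hbv, hk⟩ := hu.exists_index v
    exact ⟨k, b, hb, hbv.ne_blank, hk,
      hv.nonblank.index_eq (nonblank_getElem? hb hbv.ne_blank) ha hbv hav⟩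
  have lt_of : ∀ {k l : ℕ}, nonblankCount u k < nonblankCount u l → k < l :=
    fun h => lt_of_not_ge fun h' => absurd (nonblankCount_mono u h') (not_le_of_gt h)
  cases ht with
  | before ha hb hl hu' hv' =>
    obtain ⟨k, _, _, _, hk, hki⟩ := key ha hu'.has
    obtain ⟨l, _, _, _, hl, hli⟩ := key hb hv'.has
    have : k < l := lt_of (by omega)
    simp only [PosAtom.Holds]
    omega
  | @offset i j a b x v ha hb hl hx hv' =>
    obtain ⟨k, a', hka, hka', hk, hki⟩ := key (v := .inl x) ha hx
    obtain ⟨l, b', hlb, hlb', hl', hli⟩ := key hb hv'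
    have hlu := (List.getElem?_eq_some_iff.1 hlb).1
    have hku := (List.getElem?_eq_some_iff.1 hka).1
    simp only [PosAtom.Holds]
    rcases lt_trichotomy k l with hkl | hkl | hkl
    · have := nonblankCount_eq_add hkl hlu.le hka hka'
        fun m h1 h2 h3 => hl m (by omega) (by omega) (hg m h3)
      omega
    · subst hkl
      omega
    · have := nonblankCount_eq_add hkl hku.le hlb hlb'
        fun m h1 h2 h3 => hl m (by omega) (by omega) (hg m h3)
      omega
  | @atEnd i a x ha hl hx =>
    obtain ⟨k, a', hka, hka', hk, hki⟩ := key (v := .inl x) ha hx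
    have hku := (List.getElem?_eq_some_iff.1 hka).1
    have := nonblankCount_eq_add hku le_rfl hka hka'
      fun m h1 h2 h3 => hl m (by omega) (by rwa [nonblankCount_length] at h2) (hg m h3)
    rw [nonblankCount_length] at this
    have hsize := hu.1
    simp only [PosAtom.Holds]
    omega

/-- Irrelevance is closed under exactly these moves: if one side has no loop, or an irrelevant one,
then a loop on the other side is irrelevant. -/
theorem relevantLoop_iff_succ {p : List (Letter PV Y)} {i : ℕ} {y : Y}
    (h : p[i]? = some (∅, some y)) : A.RelevantLoop p i ↔ A.RelevantLoop p (i + 1) := by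
  constructor
  · rintro ⟨h1, h2⟩
    have h3 : A.HasLoop p (i + 1) := by
      by_contra hn
      exact h2 (.leftBase h h1 hn)
    exact ⟨h3, fun h4 => h2 (.leftStep h h1 h4)⟩
  · rintro ⟨h1, h2⟩
    have h3 : A.HasLoop p i := by
      by_contra hn
      exact h2 (.rightBase h h1 hn)
    exact ⟨h3, fun h4 => h2 (.rightStep h h1 h4)⟩

theorem pos_eq_of_has {p : List (Letter PV Y)} (hφ : ∀ t, A.PathAtom p t → t.Holds c val)
    {i : ℕ} {a : Letter PV Y} (ha : p[i]? = some a) {u v : PV ⊕ Y} (hu : a.Has u) (hv : a.Has v) :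
    c.pos val u = c.pos val v := by
  by_cases h : ∃ x, x ∈ a.1
  · obtain ⟨x, hx⟩ := h
    have h1 : ∀ {v}, a.Has v → c.pos val v = c.pos val (.inl x) := fun {v} hv => by
      -- With both letters equal there are no states in between, so this atom is always present,
      -- with distance 0.
      have := hφ _ (.offset ha ha (fun m h1 h2 => by omega) hx hv)
      simpa [PosAtom.Holds] using this
    rw [h1 hu, h1 hv]
  · cases u with
    | inl x => exact absurd ⟨x, hu⟩ h
    | inr y =>
      cases v with
      | inl x => exact absurd ⟨x, hv⟩ h
      | inr z =>
        have : y = z := Option.some.inj (hu.symm.trans hv)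
        rw [this]

/-- A letter just before `nil` would lie at a negative position: by a `before` atom across a
relevant loop, and otherwise by an `offset` atom with distance -1. -/
theorem nil_first {p : List (Letter PV Y)} (hφ : ∀ t, A.PathAtom p t → t.Holds c val)
    (hp : ∀ a ∈ p, a ≠ blank) {i : ℕ} {a : Letter PV Y} (ha : p[i]? = some a) (hn : nil ∈ a.1) :
    i = 0 := by
  cases i with
  | zero => rfl
  | succ i =>
    exfalso
    have hi : i < p.length := by
      have := (List.getElem?_eq_some_iff.1 ha).1
      omega
    have hb : p[i]? = some p[i] := List.getElem?_eq_getElem hi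
    obtain ⟨v, hv⟩ := Letter.exists_rep (hp _ (List.getElem_mem hi))
    have h0 := c.pos_nonneg val v
    have hnil := c.pos_nil val
    by_cases hl : A.RelevantLoop p (i + 1)
    · have h1 := hφ _ (.before (v := .inl nil) hb ha hl hv hn)
      simp only [PosAtom.Holds] at h1
      omega
    · have h1 := hφ _ (.offset ha hb (fun m h1 h2 => by
        obtain rfl : m = i + 1 := by omega
        exact hl) hn hv.has)
      simp only [PosAtom.Holds] at h1
      push_cast at h1
      omega

/-- A letter with no relevant self-loop behind it is at a fixed distance behind a pointer. -/
theorem exists_anchor {p : List (Letter PV Y)} (hφ : ∀ t, A.PathAtom p t → t.Holds c val)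
    (hp : ∀ a ∈ p, a ≠ blank) (hv : ValidSymbolic p) {i : ℕ} (hi : i < p.length)
    (hl : ¬ A.RelevantLoop p (i + 1)) :
    ∃ j ≤ i, ∃ b x, p[j]? = some b ∧ x ∈ b.1 ∧
      ∀ m, j < m → m ≤ i + 1 → ¬ A.RelevantLoop p m := by
  induction i with
  | zero =>
    -- The first letter carries `nil`, so tracing back always ends at a pointer.
    obtain ⟨j, b, hb, hnb⟩ := hv.exists_getElem? (.inl nil)
    obtain rfl := nil_first hφ hp hb hnb
    refine ⟨0, le_rfl, b, nil, hb, hnb, fun m h1 h2 => ?_⟩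
    obtain rfl : m = 0 + 1 := by omega
    exact hl
  | succ i ih =>
    have ha : p[i + 1]? = some p[i + 1] := List.getElem?_eq_getElem hi
    by_cases h : ∃ x, x ∈ p[i + 1].1
    · obtain ⟨x, hx⟩ := h
      refine ⟨i + 1, le_rfl, _, x, ha, hx, fun m h1 h2 => ?_⟩
      obtain rfl : m = i + 1 + 1 := by omega
      exact hl
    · obtain ⟨v, hrep⟩ := Letter.exists_rep (hp _ (List.getElem_mem hi))
      cases v with
      | inl x => exact absurd ⟨x, hrep⟩ h
      | inr y =>
        have hy : p[i + 1]? = some (∅, some y) := ha.trans (congrArg some hrep)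
        -- Without a pointer the letter is a lone universal variable, so the state before it has no
        -- relevant loop either and the search continues to the left.
        have hl' := fun h => hl ((relevantLoop_iff_succ hy).1 h)
        obtain ⟨j, hj, b, x, hb, hx, hm⟩ := ih (by omega) hl'
        refine ⟨j, by omega, b, x, hb, hx, fun m h1 h2 => ?_⟩
        rcases Nat.lt_or_ge (i + 1) m with h3 | h3
        · obtain rfl : m = i + 1 + 1 := by omega
          exact hl
        · exact hm m h1 h3

/-- The positions of the letters of a path whose structural constraint holds. -/
theorem exists_positions {p : List (Letter PV Y)} (hφ : ∀ t, A.PathAtom p t → t.Holds c val)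
    (hp : ∀ a ∈ p, a ≠ blank) (hv : ValidSymbolic p) :
    ∃ P : ℕ → ℤ,
      (∀ (i : ℕ) (a : Letter PV Y), p[i]? = some a → ∀ v, a.Has v → c.pos val v = P i) ∧ P 0 = 0 ∧
      (∀ i j, i < j → j < p.length → P i < P j) ∧
      (∀ i, i + 1 < p.length → ¬ A.RelevantLoop p (i + 1) → P (i + 1) = P i + 1) ∧
      (∀ i, i + 1 = p.length → ¬ A.RelevantLoop p (i + 1) → P i + 1 = c.size) := by
  have hex : ∀ i : ℕ, ∃ z : ℤ, ∀ a : Letter PV Y, p[i]? = some a → ∀ v, a.Has v → c.pos val v = z := by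
    intro i
    rcases h : p[i]? with _ | a
    -- Beyond the end of the path the value is arbitrary.
    · exact ⟨0, by simp⟩
    · obtain ⟨v, hr⟩ := Letter.exists_rep (hp a (List.mem_of_getElem? h))
      refine ⟨c.pos val v, fun b hb u hu => ?_⟩
      cases hb
      exact pos_eq_of_has hφ h hu hr.has
  choose P hP using hex
  have hdist : ∀ i, i + 1 < p.length → ¬ A.RelevantLoop p (i + 1) → P (i + 1) = P i + 1 := by
    intro i hi hl
    -- No atom need relate the two letters directly, for instance if both are universal; both are
    -- measured from the same pointer `x`, and the distances differ by 1.
    obtain ⟨j, hj, b, x, hb, hx, hm⟩ := exists_anchor hφ hp hv (Nat.lt_of_succ_lt hi) hl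
    obtain ⟨u, hu⟩ := Letter.exists_rep (hp _ (List.getElem_mem (Nat.lt_of_succ_lt hi)))
    obtain ⟨v, hv⟩ := Letter.exists_rep (hp _ (List.getElem_mem hi))
    have hi1 : p[i]? = some p[i] := List.getElem?_eq_getElem _
    have hi2 : p[i + 1]? = some p[i + 1] := List.getElem?_eq_getElem _
    have h1 := hφ _ (.offset hb hi1 (fun m h1 h2 => hm m (by omega) (by omega)) hx hu.has)
    have h2 := hφ _ (.offset hb hi2 (fun m h1 h2 => hm m (by omega) (by omega)) hx hv.has)
    simp only [PosAtom.Holds, hP i _ hi1 u hu.has, hP (i + 1) _ hi2 v hv.has] at h1 h2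
    push_cast at h2
    omega
  have hsucc : ∀ i, i + 1 < p.length → P i < P (i + 1) := by
    intro i hi
    by_cases hl : A.RelevantLoop p (i + 1)
    · obtain ⟨u, hu⟩ := Letter.exists_rep (hp _ (List.getElem_mem (Nat.lt_of_succ_lt hi)))
      obtain ⟨v, hv⟩ := Letter.exists_rep (hp _ (List.getElem_mem hi))
      have hi1 : p[i]? = some p[i] := List.getElem?_eq_getElem _
      have hi2 : p[i + 1]? = some p[i + 1] := List.getElem?_eq_getElem _
      have h1 := hφ _ (.before hi1 hi2 hl hu hv)
      simpa only [PosAtom.Holds, hP i _ hi1 u hu.has, hP (i + 1) _ hi2 v hv.has] using h1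
    · have := hdist i hi hl
      omega
  refine ⟨P, hP, ?_, ?_, hdist, ?_⟩
  · obtain ⟨j, b, hb, hnb⟩ := hv.exists_getElem? (.inl nil)
    obtain rfl := nil_first hφ hp hb hnb
    rw [← hP 0 b hb _ hnb, c.pos_nil]
  · intro i j hij
    induction j, hij using Nat.le_induction with
    | base => exact hsucc i
    | succ j _ ih => exact fun hj => (ih (Nat.lt_of_succ_lt hj)).trans (hsucc j hj)
  · intro i hi hl
    obtain ⟨j, hj, b, x, hb, hx, hm⟩ := exists_anchor hφ hp hv (by omega) hl
    have hi0 : i < p.length := by omega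
    obtain ⟨u, hu⟩ := Letter.exists_rep (hp _ (List.getElem_mem hi0))
    have hi1 : p[i]? = some p[i] := List.getElem?_eq_getElem _
    have h1 := hφ _ (.offset hb hi1 (fun m h1 h2 => hm m (by omega) (by omega)) hx hu.has)
    have h2 := hφ _ (.atEnd hb (fun m h1 h2 => hm m (by omega) (by omega)) hx)
    simp only [PosAtom.Holds, hP i _ hi1 u hu.has] at h1 h2
    omega

/-- A letter carries at most one universal variable, and letters of `p` are at strictly increasing
positions. -/
theorem injective_of_pathAtoms {p : List (Letter PV Y)}
    (hφ : ∀ t, A.PathAtom p t → t.Holds c val) (hp : ∀ a ∈ p, a ≠ blank) (hv : ValidSymbolic p) :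
    Function.Injective val := by
  obtain ⟨P, hP, -, hmono, -⟩ := exists_positions hφ hp hv
  intro y z hyz
  obtain ⟨i, a, ha, hay⟩ := hv.exists_getElem? (.inr y)
  obtain ⟨j, b, hb, hbz⟩ := hv.exists_getElem? (.inr z)
  have h1 := hP i a ha _ hay
  have h2 := hP j b hb _ hbz
  have h3 : c.pos val (.inr y) = c.pos val (.inr z) := by simp only [Config.pos, hyz]
  have hi := (List.getElem?_eq_some_iff.1 ha).1
  have hj := (List.getElem?_eq_some_iff.1 hb).1
  rcases lt_trichotomy i j with hij | rfl | hij
  · have := hmono i j hij hj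
    omega
  · have hab : a = b := Option.some.inj (ha.symm.trans hb)
    subst hab
    exact Option.some.inj (hay.symm.trans hbz)
  · have := hmono j i hij hi
    omega

/-- If the structural constraint of a path holds, the word of the configuration follows the path. -/
theorem run_eq_of_pathAtoms {p : List (Letter PV Y)}
    (hφ : ∀ t, A.PathAtom p t → t.Holds c val) (hp : ∀ a ∈ p, a ≠ blank) (hv : ValidSymbolic p)
    {u : List (Letter PV Y)} (hu : c.Spells val u) : A.run u = A.run p := by
  obtain ⟨P, hP, hP0, hmono, hdist, hend⟩ := exists_positions hφ hp hv
  have hpos : ∀ i, i < p.length → ∃ v, c.pos val v = P i ∧ ∃ a, p[i]? = some a ∧ a.Has v := by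
    intro i hi
    obtain ⟨v, hr⟩ := Letter.exists_rep (hp _ (List.getElem_mem hi))
    have hi1 : p[i]? = some p[i] := List.getElem?_eq_getElem _
    exact ⟨v, hP i _ hi1 v hr.has, _, hi1, hr.has⟩
  have hinj : ∀ i j, i < p.length → j < p.length → P i = P j → i = j := by
    intro i j hi hj h
    rcases lt_trichotomy i j with hij | hij | hij
    · exact absurd h (hmono i j hij hj).ne
    · exact hij
    · exact absurd h (hmono j i hij hi).ne'
  -- Invariant: if exactly the first `m` letters of `p` lie among the first `k` cells, then both
  -- prefixes reach the same state. The induction is on `k`, according to whether the last cell read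
  -- carries a letter of `p`.
  have key : ∀ k ≤ u.length, ∀ m ≤ p.length, (∀ i, i < m → P i < k) →
      (∀ i, m ≤ i → i < p.length → (k : ℤ) ≤ P i) → A.run (u.take k) = A.run (p.take m) := by
    intro k
    induction k with
    | zero =>
      intro _ m _ h1 _
      have : m = 0 := by
        by_contra hm
        have := h1 0 (by omega)
        rw [hP0] at this
        simp at this
      simp [this]
    | succ k ih =>
      intro hk m hm h1 h2
      have hku : u[k]? = some u[k] := List.getElem?_eq_getElem _
      have hspell := hu.2 k _ hku
      rw [A.run_take_succ hku]
      by_cases hlast : ∃ i, i + 1 = m ∧ P i = k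
      · obtain ⟨i, rfl, hik⟩ := hlast
        have hip : p[i]? = some p[i] := List.getElem?_eq_getElem _
        have hletter : u[k] = p[i] := by
          refine Letter.eq_of_has_iff fun v => ?_
          rw [hspell v]
          constructor
          · intro hvk
            obtain ⟨j, b, hb, hbv⟩ := hv.exists_getElem? v
            have hj := hP j b hb v hbv
            have := hinj j i (List.getElem?_eq_some_iff.1 hb).1 hm (by omega)
            subst this
            rw [hip] at hb
            cases hb
            exact hbv
          · intro h
            rw [hP i _ hip v h, hik]
        rw [A.run_take_succ hip, hletter, ih (by omega) i (by omega)]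
        · intro j hj
          have := hmono j i hj hm
          omega
        · intro j hj hjp
          rcases Nat.eq_or_lt_of_le hj with rfl | hj
          · omega
          · have := hmono i j hj hjp
            omega
      · have hlt : ∀ i, i < m → P i < k := by
          intro i hi
          have h3 := h1 i hi
          push_cast at h3
          refine lt_of_le_of_ne (by omega) fun heq => ?_
          rcases Nat.eq_or_lt_of_le (Nat.succ_le_of_lt hi) with h4 | h4
          · exact hlast ⟨i, h4, heq⟩
          · have h5 := hmono i (i + 1) (by omega) (by omega)
            have h6 := h1 (i + 1) h4
            push_cast at h6
            omega
        have hge : ∀ i, m ≤ i → i < p.length → (k : ℤ) + 1 ≤ P i := by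
          intro i hi hip
          have := h2 i hi hip
          push_cast at this
          exact this
        have hblank : u[k] = blank := by
          refine Letter.eq_of_has_iff fun v => ?_
          rw [hspell v]
          refine iff_of_false (fun hvk => ?_) (Letter.not_has_blank v)
          obtain ⟨j, b, hb, hbv⟩ := hv.exists_getElem? v
          have hj := hP j b hb v hbv
          have hjp := (List.getElem?_eq_some_iff.1 hb).1
          rcases Nat.lt_or_ge j m with h | h
          · have := hlt j h
            omega
          · have := hge j h hjp
            omega
        have hp0 : 0 < p.length := by
          obtain ⟨j, b, hb, -⟩ := hv.exists_getElem? (.inl nil)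
          have := (List.getElem?_eq_some_iff.1 hb).1
          omega
        -- Letter 0 is at cell 0, so a blank cell always comes after some letter.
        have hm0 : m ≠ 0 := by
          rintro rfl
          have := hge 0 le_rfl hp0
          omega
        obtain ⟨i, rfl⟩ := Nat.exists_eq_succ_of_ne_zero hm0
        have hi := hlt i (by omega)
        -- The blank cell `k` lies strictly between letter `i` and the next letter, or the end of
        -- the structure. Without a relevant loop there would be no room for it.
        have hrel : A.RelevantLoop p (i + 1) := by
          by_contra hn
          rcases Nat.eq_or_lt_of_le hm with h | h
          · have := hend i h hn
            have := hu.1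
            omega
          · have h3 := hdist i h hn
            have h4 := hge (i + 1) le_rfl h
            omega
        obtain ⟨⟨q, hq, hqb⟩, -⟩ := hrel
        rw [ih (by omega) (i + 1) hm hlt (fun j h3 h4 => by have := hge j h3 h4; omega), hblank, hq]
        exact hqb
  have := key u.length le_rfl p.length le_rfl (fun i hi => ?_) (fun i h1 h2 => by omega)
  · simpa using this
  · obtain ⟨v, hvi, -⟩ := hpos i hi
    rw [← hvi, hu.1]
    exact c.pos_lt val v

end Positions

end QDA

/-! ### Semantics of the guards -/

section Guards

variable {PV Y D : Type*} {aux : Finset PV} {nil : PV} {c : Config D aux nil} {val : Y → c.Cell}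

theorem StrandGuard.holds_conj (l : List (StrandGuard PV Y)) :
    (StrandGuard.conj l).Holds c val ↔ ∀ g ∈ l, g.Holds c val := by
  induction l with
  | nil => simp [StrandGuard.conj, StrandGuard.Holds]
  | cons g l ih =>
    simp only [StrandGuard.conj, List.foldr_cons, StrandGuard.Holds, List.forall_mem_cons] at ih ⊢
    rw [ih]

theorem StrandGuard.holds_disj (l : List (StrandGuard PV Y)) :
    (StrandGuard.disj l).Holds c val ↔ ∃ g ∈ l, g.Holds c val := by
  induction l with
  | nil => simp [StrandGuard.disj, StrandGuard.Holds]
  | cons g l ih =>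
    simp only [StrandGuard.disj, List.foldr_cons, StrandGuard.Holds, List.exists_mem_cons_iff]
      at ih ⊢
    rw [ih]

theorem APFGuard.holds_conj (l : List (APFGuard PV Y)) :
    (APFGuard.conj l).Holds c val ↔ ∀ g ∈ l, g.Holds c val := by
  induction l with
  | nil => simp [APFGuard.conj, APFGuard.Holds]
  | cons g l ih =>
    simp only [APFGuard.conj, List.foldr_cons, APFGuard.Holds, List.forall_mem_cons] at ih ⊢
    rw [ih]

theorem APFGuard.holds_disj (l : List (APFGuard PV Y)) :
    (APFGuard.disj l).Holds c val ↔ ∃ g ∈ l, g.Holds c val := by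
  induction l with
  | nil => simp [APFGuard.disj, APFGuard.fls, APFGuard.Holds, IdxTerm.value]
  | cons g l ih =>
    simp only [APFGuard.disj, List.foldr_cons, APFGuard.Holds, List.exists_mem_cons_iff] at ih ⊢
    rw [ih]

theorem mem_univPairs [Fintype Y] (t : Y × Y) : t ∈ univPairs Y ↔ t.1 ≠ t.2 := by
  simp [univPairs]

theorem StrandGuard.holds_distinct [Fintype Y] :
    (StrandGuard.distinct PV Y).Holds c val ↔ Function.Injective val := by
  have hval : ∀ y z, val y = val z ↔ c.pos val (.inr y) = c.pos val (.inr z) := by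
    intro y z
    simp [Config.pos, Subtype.ext_iff, Fin.ext_iff]
  simp only [StrandGuard.distinct, StrandGuard.holds_conj, List.forall_mem_map, mem_univPairs,
    Prod.forall, StrandGuard.Holds, PosAtom.Holds, ← ne_iff_lt_or_gt]
  refine forall₂_congr fun y z => ?_
  rw [hval]
  tauto

theorem IdxTerm.value_ofVar (v : PV ⊕ Y) : (IdxTerm.ofVar v).value c val = c.pos val v := by
  cases v <;> simp [IdxTerm.ofVar, IdxTerm.value]

theorem IdxTerm.value_ptr (x : PV) (k : ℤ) :
    (IdxTerm.ptr x k : IdxTerm PV Y).value c val = c.pos val (.inl x) + k := rfl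

/-- Over the integers `<` is `≤` with a shift by 1, which the index terms allow on pointers.
Strictness is lost only between two universal variables, and then only by letting them coincide. -/
theorem PosAtom.holds_of_toAPF {t : PosAtom PV Y} (h : t.toAPF.Holds c val) :
    t.Holds c val ∨ ∃ y z, t.relaxedPair = some (y, z) ∧ val y = val z := by
  cases t with
  | before u v =>
    rcases u with x | y
    · left
      simp only [PosAtom.toAPF, APFGuard.Holds, IdxTerm.value_ofVar, IdxTerm.value_ptr] at h
      simp only [PosAtom.Holds]
      omega
    · rcases v with x | z
      · left
        simp only [PosAtom.toAPF, APFGuard.Holds, IdxTerm.value] at h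
        simp only [PosAtom.Holds]
        omega
      · simp only [PosAtom.toAPF, APFGuard.Holds, IdxTerm.value] at h
        rcases h.lt_or_eq with h | h
        · exact Or.inl h
        · refine Or.inr ⟨y, z, rfl, ?_⟩
          simpa [Config.pos, Subtype.ext_iff, Fin.ext_iff] using h
  | offset v x k =>
    left
    simpa only [PosAtom.toAPF, APFGuard.Holds, IdxTerm.value_ofVar, IdxTerm.value_ptr,
      PosAtom.Holds] using h
  | atEnd x k =>
    left
    simpa [PosAtom.toAPF, APFGuard.Holds, IdxTerm.value, PosAtom.Holds] using h

/-- A disequality of integers splits into two inequalities shifted by 1. Atoms between two universal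
variables yield no guard and require nothing here. -/
theorem PosAtom.not_holds_of_negAPF {t : PosAtom PV Y} {g : APFGuard PV Y}
    (hg : t.negAPF = some g) (h : g.Holds c val) : ¬ t.Holds c val := by
  have hbefore : ∀ u v, (APFGuard.le (.ofVar v) (.ofVar u) : APFGuard PV Y).Holds c val →
      ¬ (PosAtom.before u v).Holds c val := by
    intro u v h
    simpa only [APFGuard.Holds, IdxTerm.value_ofVar, PosAtom.Holds, not_lt] using h
  cases t with
  | before u v =>
    rcases u with x | y
    · cases hg
      exact hbefore _ _ h
    · rcases v with x | z
      · cases hg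
        exact hbefore _ _ h
      · cases hg
  | offset v x k =>
    cases hg
    simp only [APFGuard.Holds, IdxTerm.value_ofVar, IdxTerm.value_ptr] at h
    simp only [PosAtom.Holds]
    omega
  | atEnd x k =>
    cases hg
    simp only [APFGuard.Holds, IdxTerm.value] at h
    simp only [PosAtom.Holds]
    omega

theorem realize_dataEqs {L : FirstOrder.Language} [L.Structure D] (l : List (Y × Y)) (s : Y → D) :
    (dataEqs L l).Realize s ↔ ∃ t ∈ l, s t.1 = s t.2 := by
  induction l with
  | nil => simp [dataEqs]
  | cons t l ih =>
    simp only [dataEqs, List.map_cons, List.foldr_cons, FirstOrder.Language.Formula.realize_sup,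
      List.exists_mem_cons_iff] at ih ⊢
    rw [ih]
    simp [FirstOrder.Language.Formula.realize_equal]

end Guards

/-! ### Path constraints as enumerated in the formulas -/

namespace QDA

section Translation

variable {PV Y F Q D : Type*} [Finite PV] [Fintype Y] {aux : Finset PV} {nil : PV}
  {c : Config D aux nil} {val : Y → c.Cell} (A : QDA PV Y F Q)

theorem mem_pathAtoms (p : List (Letter PV Y)) (t : PosAtom PV Y) :
    t ∈ A.pathAtoms p ↔ A.PathAtom p t := by
  simp [pathAtoms]

theorem holds_strandGuard (p : List (Letter PV Y)) :
    (A.strandGuard p).Holds c val ↔ ∀ t, A.PathAtom p t → t.Holds c val := by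
  simp [strandGuard, StrandGuard.holds_conj, mem_pathAtoms, StrandGuard.Holds]

theorem mem_outputPaths [Finite Q] [SemilatticeSup F] [BoundedOrder F] (p : List (Letter PV Y)) :
    p ∈ A.outputPaths ↔ A.IsOutputPath p := by
  simp [outputPaths]

end Translation

end QDA

/-! ### Encodings of configurations -/

section Encodings

variable {PV Y D : Type*} {aux : Finset PV} {nil : PV} {c : Config D aux nil}
  {w : List (Finset PV × D)}

theorem Config.Encodes.mem_iff (hc : c.Encodes w) {k : ℕ} {b : Finset PV × D}
    (hb : w[k]? = some b) (x : PV) : x ∈ b.1 ↔ (c.ptr x : ℕ) = k := by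
  obtain ⟨h, hw⟩ := hc
  obtain ⟨hk, rfl⟩ := List.getElem?_eq_some_iff.1 hb
  exact ((hw ⟨k, hk⟩).1 x).trans Fin.ext_iff

theorem Config.Encodes.data_eq (hc : c.Encodes w) {k : ℕ} {b : Finset PV × D}
    (hb : w[k]? = some b) (i : c.Cell) (hi : (i.1 : ℕ) = k) : b.2 = c.data i := by
  obtain ⟨h, hw⟩ := hc
  obtain ⟨hk, rfl⟩ := List.getElem?_eq_some_iff.1 hb
  have hcast : i.1 = Fin.cast h ⟨k, hk⟩ := Fin.ext hi
  have hi' : ∀ x ∈ aux, c.ptr x ≠ Fin.cast h ⟨k, hk⟩ := by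
    rw [← hcast]
    exact i.2
  have : i = ⟨Fin.cast h ⟨k, hk⟩, hi'⟩ := Subtype.ext hcast
  rw [this]
  exact (hw ⟨k, hk⟩).2 hi'

theorem Config.Encodes.isDataWord (hc : c.Encodes w) : IsDataWord w := by
  obtain ⟨h, hw⟩ := hc
  intro x
  refine ⟨Fin.cast h.symm (c.ptr x), ((hw _).1 x).2 (by simp), fun i hi => ?_⟩
  have := ((hw i).1 x).1 hi
  simp [this]

theorem Config.Spells.validSymbolic {val : Y → c.Cell} {u : List (Letter PV Y)}
    (h : c.Spells val u) : ValidSymbolic u := by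
  have key : ∀ v, ∃! i : Fin u.length, (u.get i).Has v := by
    intro v
    obtain ⟨k, a, ha, hav, hk⟩ := h.exists_index v
    obtain ⟨hku, rfl⟩ := List.getElem?_eq_some_iff.1 ha
    refine ⟨⟨k, hku⟩, hav, fun i hi => Fin.ext ?_⟩
    have := (h.2 i _ (List.getElem?_eq_getElem i.2) v).1 hi
    exact Int.ofNat_inj.1 (this.symm.trans hk)
  exact ⟨fun x => key (.inl x), fun y => key (.inr y)⟩

/-- The valuation word of a configuration under an injective valuation. -/
theorem Config.Encodes.exists_valuationWord (hc : c.Encodes w) {val : Y → c.Cell}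
    (hval : Function.Injective val) :
    ∃ v : List (Finset PV × D × Option Y), toDataWord v = w ∧ c.Spells val (toSymbolic v) ∧
      ∀ a ∈ v, ∀ y, a.2.2 = some y → a.2.1 = c.data (val y) := by
  classical
  -- The universal variable at cell `k`; injectivity of `val` makes the choice unique.
  let o : ℕ → Option Y := fun k =>
    if h : ∃ y, ((val y).1 : ℕ) = k then some h.choose else none
  have ho : ∀ k y, o k = some y ↔ ((val y).1 : ℕ) = k := by
    intro k y
    simp only [o]
    split_ifs with h
    · rw [Option.some.injEq]
      constructor
      · rintro rfl
        exact h.choose_spec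
      · intro hy
        exact hval (Subtype.ext (Fin.ext (h.choose_spec.trans hy.symm)))
    · simpa using fun hy => h ⟨y, hy⟩
  refine ⟨w.mapIdx fun k b => (b.1, b.2, o k), ?_, ⟨?_, ?_⟩, ?_⟩
  · refine List.ext_getElem? fun k => ?_
    simp only [toDataWord, List.getElem?_map, List.getElem?_mapIdx, Option.map_map]
    cases w[k]? <;> rfl
  · simp [toSymbolic, hc.1]
  · intro k a ha v
    simp only [toSymbolic, List.getElem?_map, List.getElem?_mapIdx, Option.map_map,
      Option.map_eq_some_iff, Function.comp_apply] at ha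
    obtain ⟨b, hb, rfl⟩ := ha
    cases v with
    | inl x => simpa [Letter.Has, Config.pos] using hc.mem_iff hb x
    | inr y => simpa [Letter.Has, Config.pos] using ho k y
  · intro a ha y hy
    obtain ⟨k, hk, rfl⟩ := List.mem_iff_getElem.1 ha
    simp only [List.getElem_mapIdx] at hy ⊢
    exact hc.data_eq (List.getElem?_eq_getElem _) _ ((ho k y).1 hy)

theorem IsValuationWord.exists_values {v : List (Finset PV × D × Option Y)}
    (hv : IsValuationWord v) :
    ∃ s : Y → D, ∀ a ∈ v, ∀ y, a.2.2 = some y → a.2.1 = s y := by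
  choose i hi hu using hv.2
  refine ⟨fun y => (v.get (i y)).2.1, fun a ha y hy => ?_⟩
  obtain ⟨k, hk, rfl⟩ := List.mem_iff_getElem.1 ha
  beta_reduce
  rw [← hu y ⟨k, hk⟩ hy]
  rfl

/-- A valuation word of a configuration whose universal variables are at proper cells stems from a
valuation in the configuration. -/
theorem Config.Encodes.exists_valuation {v : List (Finset PV × D × Option Y)}
    (hc : c.Encodes (toDataWord v)) (hv : IsValuationWord v)
    (hproper : ¬ ∃ a ∈ toSymbolic v, ∃ x ∈ aux, x ∈ a.1 ∧ ∃ y, a.2 = some y) :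
    ∃ val : Y → c.Cell, Function.Injective val ∧ c.Spells val (toSymbolic v) ∧
      ∀ a ∈ v, ∀ y, a.2.2 = some y → a.2.1 = c.data (val y) := by
  have hlen : v.length = c.size := by simpa [toDataWord] using hc.1
  have hword : ∀ {k : ℕ} {a : Finset PV × D × Option Y}, v[k]? = some a →
      (toDataWord v)[k]? = some (a.1, a.2.1) := by
    intro k a ha
    simp [toDataWord, ha]
  choose i hi hu using hv.2
  -- An auxiliary pointer at the cell of `y` would share its letter, which `hproper` excludes.
  have hcell : ∀ y, ∀ x ∈ aux, c.ptr x ≠ Fin.cast hlen (i y) := by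
    intro y x hx heq
    refine hproper ⟨_, List.mem_map_of_mem (List.get_mem v (i y)), x, hx, ?_, y, hi y⟩
    refine (hc.mem_iff (hword (List.getElem?_eq_getElem (i y).2)) x).2 ?_
    rw [heq]
    rfl
  have hiff : ∀ {k : ℕ} {a : Finset PV × D × Option Y}, v[k]? = some a → ∀ y,
      a.2.2 = some y ↔ (i y : ℕ) = k := by
    intro k a ha y
    obtain ⟨hk, rfl⟩ := List.getElem?_eq_some_iff.1 ha
    constructor
    · intro h
      exact congrArg Fin.val (hu y ⟨k, hk⟩ h).symm
    · rintro rfl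
      exact hi y
  refine ⟨fun y => ⟨Fin.cast hlen (i y), hcell y⟩, ?_, ⟨?_, ?_⟩, ?_⟩
  · intro y z hyz
    have h : i y = i z := by simpa [Subtype.ext_iff, Fin.ext_iff] using hyz
    have := hi z
    rw [← h, hi y] at this
    exact Option.some.inj this
  · simpa [toSymbolic] using hlen
  · intro k a ha u
    simp only [toSymbolic, List.getElem?_map, Option.map_eq_some_iff] at ha
    obtain ⟨b, hb, rfl⟩ := ha
    cases u with
    | inl x => simpa [Letter.Has, Config.pos] using hc.mem_iff (hword hb) x
    | inr y => simpa [Letter.Has, Config.pos] using hiff hb y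
  · intro a ha y hy
    obtain ⟨k, hk, rfl⟩ := List.mem_iff_getElem.1 ha
    have hb := List.getElem?_eq_getElem hk
    exact hc.data_eq (hword hb) _ ((hiff hb y).1 hy)

end Encodings

/-! ### Correctness of the translations -/

namespace QDA

variable {PV Y D F Q : Type*} [SemilatticeSup F] [BoundedOrder F]
  {L : FirstOrder.Language} [L.Structure D] {Φ : FormulaLattice L D Y F}
  {A : QDA PV Y F Q} {nil : PV} {aux : Finset PV} {c : Config D aux nil}
  {w : List (Finset PV × D)}

theorem pathFormula_eq {p : List (Letter PV Y)} {q : Q} (h : A.run p = some q) :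
    A.pathFormula Φ p = Φ.formula (A.out q) := by
  simp [pathFormula, h]

variable [DecidableEq Y]

/-- Under every injective valuation, some path constraint holds in a configuration that is encoded
by a word of the language. -/
theorem exists_outputPath_of_mem_language (hA : A.ChecksInput) (hE : A.Elastic)
    (hc : c.Encodes w) (hw : w ∈ A.language Φ) {val : Y → c.Cell}
    (hval : Function.Injective val) :
    ∃ p, A.IsOutputPath p ∧ ∀ t, A.PathAtom p t → t.Holds c val := by
  obtain ⟨v, hvw, hspell, hdata⟩ := hc.exists_valuationWord hval
  have hsym := hspell.validSymbolic
  have hval' := (isValuationWord_iff v).2 hsym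
  obtain ⟨q, hq, hreal⟩ := (A.acceptsValuation_iff Φ hval' hdata).1 (hw.2 v hval' hvw)
  have hbot : A.out q ≠ ⊥ := by
    intro h
    rw [h, Φ.formula_bot] at hreal
    simp at hreal
  refine ⟨_, hA.isOutputPath (fun a => ne_blank_of_mem_nonblank) (hE.run_nonblank hq) hbot,
    fun t => PathAtom.holds hspell hsym fun m hm => ⟨hE.hasLoop_of_gap hq hm, fun hirr => ?_⟩⟩
  -- The family consists of the valid words with the same pointer letters as `w`. It is closed under
  -- the exchange, because a blank and a lone universal variable carry the same empty set of
  -- pointers.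
  refine hE.not_gap_of_irrelevant
    (W := {u | ValidSymbolic u ∧ u.map Prod.fst = w.map Prod.fst}) ?_ ?_ hirr _ ⟨hsym, ?_⟩ rfl hm
  · rintro u ⟨hu, huw⟩
    have hlen : u.length = w.length := by simpa using congrArg List.length huw
    -- Adding the data of `w` turns `u` into a valuation word of `w`. It is accepted, so `u` has a
    -- run; this is where acceptance of all valuation words is needed.
    let v' : List (Finset PV × D × Option Y) := List.zipWith (fun a b => (a.1, b.2, a.2)) u w
    have h1 : toSymbolic v' = u := by
      refine List.ext_getElem (by simp [v', toSymbolic, hlen]) fun k h1 h2 => ?_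
      simp [v', toSymbolic]
    have h2 : toDataWord v' = w := by
      refine List.ext_getElem (by simp [v', toDataWord, hlen]) fun k h1 h2 => ?_
      have h3 : (u.map Prod.fst)[k]? = (w.map Prod.fst)[k]? := by rw [huw]
      simp only [List.getElem?_map, List.getElem?_eq_getElem h2,
        List.getElem?_eq_getElem (hlen ▸ h2 : k < u.length), Option.map_some,
        Option.some.injEq] at h3
      simp [v', toDataWord, h3]
    have h3 : IsValuationWord v' := (isValuationWord_iff v').2 (h1.symm ▸ hu)
    obtain ⟨s, hs⟩ := h3.exists_values
    obtain ⟨q', hq', -⟩ := (A.acceptsValuation_iff Φ h3 hs).1 (hw.2 v' h3 h2)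
    exact ⟨q', h1 ▸ hq'⟩
  · intro α β y
    have hperm : (α ++ blank :: (∅, some y) :: β : List (Letter PV Y)).Perm
        (α ++ (∅, some y) :: blank :: β) := (List.Perm.swap _ _ _).append_left α
    have hmap : (α ++ blank :: (∅, some y) :: β : List (Letter PV Y)).map Prod.fst =
        (α ++ (∅, some y) :: blank :: β).map Prod.fst := by simp [blank]
    simp only [Set.mem_ofPred_eq, hmap]
    exact and_congr_left fun _ => ⟨fun h => h.perm hperm, fun h => h.perm hperm.symm⟩
  · rw [← hvw]
    simp [toSymbolic, toDataWord]

/-- The constraint makes `val` injective, so it comes from a valuation word of `w`. That word ends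
in the last state of `p`, and its acceptance is the claim. -/
theorem realize_pathFormula (hA : A.ChecksInput) (hc : c.Encodes w) (hw : w ∈ A.language Φ)
    {p : List (Letter PV Y)} (hp : A.IsOutputPath p) {val : Y → c.Cell}
    (hφ : ∀ t, A.PathAtom p t → t.Holds c val) :
    (A.pathFormula Φ p).Realize fun y => c.data (val y) := by
  obtain ⟨hnb, -, q, hq, hbot⟩ := hp
  have hv := hA.validSymbolic hq hbot
  obtain ⟨v, hvw, hspell, hdata⟩ :=
    hc.exists_valuationWord (injective_of_pathAtoms hφ hnb hv)
  have hval := (isValuationWord_iff v).2 hspell.validSymbolic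
  obtain ⟨q', hq', hreal⟩ := (A.acceptsValuation_iff Φ hval hdata).1 (hw.2 v hval hvw)
  rw [run_eq_of_pathAtoms hφ hnb hv hspell, hq] at hq'
  cases hq'
  rwa [pathFormula_eq hq]

variable [Finite PV] [Fintype Y] [Finite Q]

theorem modelsStrand_of_mem_language (hA : A.ChecksInput) (hE : A.Elastic) (hc : c.Encodes w)
    (hw : w ∈ A.language Φ) : c.ModelsStrand (A.toStrand Φ) := by
  intro κ hκ val hg
  rcases List.mem_append.1 hκ with hκ | hκ
  · obtain ⟨p, hp, rfl⟩ := List.mem_map.1 hκ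
    exact realize_pathFormula hA hc hw ((A.mem_outputPaths p).1 hp)
      ((A.holds_strandGuard p).1 hg)
  · obtain rfl := List.mem_singleton.1 hκ
    obtain ⟨hd, hn⟩ := hg
    obtain ⟨p, hp, hφ⟩ :=
      exists_outputPath_of_mem_language hA hE hc hw (StrandGuard.holds_distinct.1 hd)
    exact absurd ((StrandGuard.holds_disj _).2
      ⟨_, List.mem_map_of_mem ((A.mem_outputPaths p).2 hp), (A.holds_strandGuard p).2 hφ⟩) hn

/-- The exit guard refutes an atom of every path constraint, while one of these constraints holds.
-/
theorem not_holds_apfExitGuard (hA : A.ChecksInput) (hE : A.Elastic) (hc : c.Encodes w)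
    (hw : w ∈ A.language Φ) {val : Y → c.Cell} (hval : Function.Injective val) :
    ¬ A.apfExitGuard.Holds c val := by
  intro h
  obtain ⟨p, hp, hφ⟩ := exists_outputPath_of_mem_language hA hE hc hw hval
  have h1 := (APFGuard.holds_conj _).1 h _ (List.mem_map_of_mem ((A.mem_outputPaths p).2 hp))
  obtain ⟨g, hg, hgh⟩ := (APFGuard.holds_disj _).1 h1
  obtain ⟨t, ht, htg⟩ := List.mem_filterMap.1 hg
  exact PosAtom.not_holds_of_negAPF htg hgh (hφ t ((A.mem_pathAtoms p t).1 ht))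

theorem modelsAPF_of_mem_language (hA : A.ChecksInput) (hE : A.Elastic) (hc : c.Encodes w)
    (hw : w ∈ A.language Φ) : c.ModelsAPF (A.toAPF Φ) := by
  intro κ hκ val hg
  rcases List.mem_append.1 hκ with hκ | hκ
  · obtain ⟨p, hp, rfl⟩ := List.mem_map.1 hκ
    rw [FirstOrder.Language.Formula.realize_sup, realize_dataEqs]
    -- Either a relaxed pair shares a cell, and hence its datum, or every relaxed atom holds
    -- strictly and the guard amounts to `φ_p`.
    by_cases heq : ∃ t, A.PathAtom p t ∧ ∃ y z, t.relaxedPair = some (y, z) ∧ val y = val z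
    · obtain ⟨t, ht, y, z, htr, hyz⟩ := heq
      refine Or.inr ⟨(y, z), List.mem_filterMap.2 ⟨t, (A.mem_pathAtoms p t).2 ht, htr⟩, ?_⟩
      simp only [hyz]
    · refine Or.inl (realize_pathFormula hA hc hw ((A.mem_outputPaths p).1 hp) fun t ht => ?_)
      have h1 := (APFGuard.holds_conj _).1 hg _
        (List.mem_map_of_mem ((A.mem_pathAtoms p t).2 ht))
      exact (PosAtom.holds_of_toAPF h1).resolve_right fun h => heq ⟨t, ht, h⟩
  · obtain rfl := List.mem_singleton.1 hκ
    rw [realize_dataEqs]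
    by_cases hval : Function.Injective val
    · exact absurd hg (not_holds_apfExitGuard hA hE hc hw hval)
    · simp only [Function.Injective, not_forall] at hval
      obtain ⟨y, z, hyz, hne⟩ := hval
      exact ⟨(y, z), (mem_univPairs _).2 hne, by simp only [hyz]⟩

/-- Valuation words with a universal variable at an auxiliary cell are accepted by `AuxTrue`. For
the others the last conjunct provides a path whose constraint holds, and the conjunct of that path
gives the output formula. -/
theorem mem_language_of_modelsStrand (hA : A.ChecksInput) (hc : c.Encodes w)
    (haux : A.AuxTrue aux nil) (hm : c.ModelsStrand (A.toStrand Φ)) : w ∈ A.language Φ := by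
  refine ⟨hc.isDataWord, ?_⟩
  rintro v hv rfl
  have hsym := (isValuationWord_iff v).1 hv
  by_cases hex : ∃ a ∈ toSymbolic v, ∃ x ∈ aux, x ∈ a.1 ∧ ∃ y, a.2 = some y
  · obtain ⟨s, hs⟩ := hv.exists_values
    have hlen : (toDataWord v).length = v.length := by simp [toDataWord]
    -- The cell of `nil` exists, so there is a first letter, and it carries `nil` as `AuxTrue`
    -- demands.
    have hpos : 0 < v.length := by
      rw [← hlen, hc.1]
      exact (c.ptr nil).pos
    have h0 : (toDataWord v)[0]? = some (v[0].1, v[0].2.1) := by simp [toDataWord, hpos]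
    obtain ⟨q, hq, htop⟩ := haux _ hsym
      ⟨(v[0].1, v[0].2.2), by simp [toSymbolic, List.head?_eq_getElem?, hpos],
        (hc.mem_iff h0 nil).2 c.ptr_nil⟩ hex
    refine (A.acceptsValuation_iff Φ hv hs).2 ⟨q, hq, ?_⟩
    rw [htop, Φ.formula_top]
    simp
  · obtain ⟨val, hval, hspell, hdata⟩ := hc.exists_valuation hv hex
    have hsome : ∃ p, A.IsOutputPath p ∧ ∀ t, A.PathAtom p t → t.Holds c val := by
      by_contra hno
      refine hm _ (List.mem_append_right _ (List.mem_singleton_self _)) val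
        ⟨StrandGuard.holds_distinct.2 hval, fun hd => ?_⟩
      obtain ⟨g, hg, hgh⟩ := (StrandGuard.holds_disj _).1 hd
      obtain ⟨p, hp, rfl⟩ := List.mem_map.1 hg
      exact hno ⟨p, (A.mem_outputPaths p).1 hp, (A.holds_strandGuard p).1 hgh⟩
    obtain ⟨p, hp, hφ⟩ := hsome
    have hreal := hm _ (List.mem_append_left _ (List.mem_map_of_mem ((A.mem_outputPaths p).2 hp)))
      val ((A.holds_strandGuard p).2 hφ)
    obtain ⟨hnb, -, q, hq, hbot⟩ := hp
    refine (A.acceptsValuation_iff Φ hv hdata).2 ⟨q, ?_, ?_⟩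
    · rw [run_eq_of_pathAtoms hφ hnb (hA.validSymbolic hq hbot) hspell, hq]
    · simpa only [pathFormula_eq hq] using hreal

end QDA

theorem theorem4 {PV Y D F Q : Type*} [Finite PV] [Fintype Y] [DecidableEq Y] [Finite Q]
    [Finite F] [SemilatticeSup F] [BoundedOrder F]
    (L : FirstOrder.Language) [L.Structure D] (Φ : FormulaLattice L D Y F)
    (A : QDA PV Y F Q) (hA : A.ChecksInput) (hE : A.Elastic)
    (nil : PV) (aux : Finset PV) (c : Config D aux nil) (w : List (Finset PV × D))
    (hc : c.Encodes w) :
    (w ∈ A.language Φ →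
      c.ModelsStrand (A.toStrand Φ) ∧ c.ModelsAPF (A.toAPF Φ) ∧
        ∀ val : Y → c.Cell, Function.Injective val → ¬ A.apfExitGuard.Holds c val) ∧
    (A.AuxTrue aux nil → c.ModelsStrand (A.toStrand Φ) → w ∈ A.language Φ) := by
  exact ⟨fun hw => ⟨QDA.modelsStrand_of_mem_language hA hE hc hw,
    QDA.modelsAPF_of_mem_language hA hE hc hw,
    fun _ hval => QDA.not_holds_apfExitGuard hA hE hc hw hval⟩,
    fun haux hm => QDA.mem_language_of_modelsStrand hA hc haux hm⟩
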